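/- Let $\mathbb T=\mathbb R/2\pi\mathbb Z$ and, for a real function $f$ on $\mathbb T$, let $$\Lambda^{-1}f(\alpha)=-\frac1{2\pi}\int_{-\pi}^{\pi}\log\!\Big(4\sin^2\Big(\frac{\alpha-\beta}{2}\Big)\Big)f(\beta)\,d\beta,\qquad \hat f(k)=\frac1{2\pi}\int_{-\pi}^{\pi}f(\alpha)e^{-ik\alpha}\,d\alpha,$$ $$\|f\|_{\dot H^3}^2=\sum_{k\in\mathbb Z}|k|^{6}|\hat f(k)|^2,\qquad \|f\|_{H^3}^2=\sum_{k\in\mathbb Z}(1+k^2)^{3}|\hat f(k)|^2 .$$ **Theorem (existence of solutions for small data).** There are constants $\varepsilon>0$ and $C>0$ such that for every real-valued $u_0\in\dot H^3(\mathbb T)$ with zero mean and $\|u_0\|_{\dot H^3}\le\varepsilon$ there is a function $u:[0,\infty)\times\mathbb T\to\mathbb R$ such that, for every $T>0$, $u\in C([0,T],H^3(\mathbb T))$ and $u$ is a solution of the Cauchy problem $$u_t+u^2u_\alpha=-\Lambda^{-1}u\quad\text{on }\mathbb T\times[0,T],\qquad u(\cdot,0)=u_0,$$ where each $u(\cdot,t)$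 is identified with its $C^2$ representative and the equation holds at every point in the classical sense (with one-sided time derivatives at $t=0$ and $t=T$). Moreover, $$\|u(\cdot,t)\|_{L^2(\mathbb T)}\le C(1+t)^{-1.25}\qquad\text{for all }t\ge0 .$$ -/

import Mathlib

open Real MeasureTheory Set Filter Topology

noncomputable section

namespace CubicLocalModel

/-- The one-dimensional torus `ℝ / 2πℤ`. -/
abbrev Torus : Type := AddCircle (2 * π)

instance : Fact (0 < 2 * π) := ⟨two_pi_pos⟩

/-- The Fourier coefficients `(2π)⁻¹ ∫ f(α) e^{-ikα} dα` of a real function on the torus. -/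
def coeff (f : Torus → ℝ) (k : ℤ) : ℂ := fourierCoeff (fun x => (f x : ℂ)) k

/-- Membership in the inhomogeneous Sobolev space `H^s(𝕋)`. -/
def MemH (s : ℕ) (f : Torus → ℝ) : Prop :=
  MemLp f 2 volume ∧ Summable fun k : ℤ => (1 + (k : ℝ) ^ 2) ^ s * ‖coeff f k‖ ^ 2

/-- The norm of `H^s(𝕋)`; meaningful for `f` with `MemH s f`. -/
def normH (s : ℕ) (f : Torus → ℝ) : ℝ :=
  √(∑' k : ℤ, (1 + (k : ℝ) ^ 2) ^ s * ‖coeff f k‖ ^ 2)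

/-- Membership in the homogeneous Sobolev space `Ḣ^s(𝕋)`. -/
def MemHdot (s : ℕ) (f : Torus → ℝ) : Prop :=
  MemLp f 2 volume ∧ Summable fun k : ℤ => |(k : ℝ)| ^ (2 * s) * ‖coeff f k‖ ^ 2

/-- The (semi)norm of `Ḣ^s(𝕋)`; meaningful for `f` with `MemHdot s f`. -/
def normHdot (s : ℕ) (f : Torus → ℝ) : ℝ :=
  √(∑' k : ℤ, |(k : ℝ)| ^ (2 * s) * ‖coeff f k‖ ^ 2)

/-- `u ∈ C(I, H^s(𝕋))`: every `u t` with `t ∈ I` lies in `H^s`, and `t ↦ u t` is continuous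
on `I` for the `H^s` norm. -/
def ContinuousInH (s : ℕ) (I : Set ℝ) (u : ℝ → Torus → ℝ) : Prop :=
  (∀ t ∈ I, MemH s (u t)) ∧
    ∀ t ∈ I, Tendsto (fun r => normH s (u r - u t)) (𝓝[I] t) (𝓝 0)

/-- The operator `Λ⁻¹`, given by its periodic logarithmic kernel, as a function of the angle
`α ∈ ℝ`. -/
def LambdaInv (f : Torus → ℝ) (α : ℝ) : ℝ :=
  -(1 / (2 * π)) * ∫ β in (-π)..π, log (4 * sin ((α - β) / 2) ^ 2) * f (β : Torus)

/-- `u ∈ C([0,T], H³)` is a solution on `𝕋 × [0,T]` of `u_t + u² u_α = -Λ⁻¹ u` with initial datum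
`u₀` (an element of `L²`, hence prescribed almost everywhere). The function `u t ∈ H³` is
given by its `C²` representative, so that `u_α` is a classical derivative, and the equation holds
at every point (with one-sided time derivatives at `t = 0` and `t = T`). -/
structure IsSolution (T : ℝ) (u₀ : Torus → ℝ) (u : ℝ → Torus → ℝ) : Prop where
  continuousInH : ContinuousInH 3 (Icc 0 T) u
  contDiff : ∀ t ∈ Icc 0 T, ContDiff ℝ 2 fun α : ℝ => u t (α : Torus)
  equation : ∀ t ∈ Icc 0 T, ∀ α : ℝ,
    ∃ ut : ℝ, HasDerivWithinAt (fun r => u r (α : Torus)) ut (Icc 0 T) t ∧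
      ut + u t (α : Torus) ^ 2 * deriv (fun a : ℝ => u t (a : Torus)) α = -LambdaInv (u t) α
  initial : u 0 =ᵐ[volume] u₀

end CubicLocalModel

end

noncomputable section

namespace CubicLocalModel

section

/-! ## Symmetrization of the cubic nonlinearity on the Fourier side -/

/-! Since `u² u_α = (u³)_α / 3` and `Λ⁻¹` divides the `k`-th Fourier coefficient by `|k|`, the
equation becomes the infinite system `a_k' = rhs a k`. Everything is proved for this system, and the
function is recovered by Fourier synthesis only at the end.

The difficulty is that the damping gains nothing at high frequency, while the nonlinearity costs a
derivative. The derivative of the `Ḣ³` energy contains `∑ k⁷ conj(a_k) (a*a*a)_k`. Symmetrized over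
four frequencies of sum zero, its symbol is `m⁷ + p⁷ + q⁷ + r⁷`, and cancellation between the two
largest frequencies bounds it by a multiple of `|m|³|p|³|q||r|` (`IsTame.symbol_le`). The nonlinear
term is thus at most a constant times `‖u‖²_{Ḣ³} (∑ |k||a_k|)²`. By Cauchy-Schwarz the last factor
is controlled by `∑ |k|⁵|a_k|²`, which is the damping of the `Ḣ³` energy. Small data therefore never
leave the `Ḣ³` ball (`IsGalerkin.sobolev_le`).

For the `L²` energy the symbol is `m + p + q + r = 0`, so only the damping `∑ |a_k|²/|k|` remains.
Interpolating it against the bounded `Ḣ³` norm at scale `1 + t` gives decay of `‖u‖²` like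
`(1+t)⁻⁴`, more than is asked (`IsGalerkin.energy_decay`).

Solutions come from Galerkin truncations, for which both estimates hold uniformly, and from a
coefficientwise limit along an ultrafilter (`exists_isSpectral`). The limit is only weakly
continuous in `Ḣ³` a priori. The same symbol bound, for the weights `k⁷` cut off at frequency `n`
and uniformly in `n`, makes the `Ḣ³` energy Lipschitz in time, and convergence of norms upgrades
weak to strong continuity (`tendsto_tsum_norm_sub_sq`). The logarithmic kernel is identified with
the multiplier `1/|k|` by an explicit primitive (`integral_logKernel_mul_pow`). -/

/-- The coefficients of the cube of the function with coefficients `a`. -/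
def conv3 (a : ℤ → ℂ) (k : ℤ) : ℂ :=
  ∑' p : ℤ × ℤ, a p.1 * a p.2 * a (k - p.1 - p.2)

/-- Coefficients of a real function of zero mean. -/
structure IsRealSeq (a : ℤ → ℂ) : Prop where
  zero : a 0 = 0
  neg : ∀ k, a (-k) = starRingEnd ℂ (a k)

/-- Exchange of the first two frequencies. -/
def swapFst : ℤ × ℤ × ℤ ≃ ℤ × ℤ × ℤ where
  toFun x := (x.2.1, x.1, x.2.2)
  invFun x := (x.2.1, x.1, x.2.2)
  left_inv _ := rfl
  right_inv _ := rfl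

/-- Exchange of the second and third frequencies. -/
def swapSnd : ℤ × ℤ × ℤ ≃ ℤ × ℤ × ℤ where
  toFun x := (x.1, x.2.2, x.2.1)
  invFun x := (x.1, x.2.2, x.2.1)
  left_inv _ := rfl
  right_inv _ := rfl

/-- Exchange of the third frequency with the fourth one, which is minus the sum of the others. -/
def swapLast : ℤ × ℤ × ℤ ≃ ℤ × ℤ × ℤ where
  toFun x := (x.1, x.2.1, -x.1 - x.2.1 - x.2.2)
  invFun x := (x.1, x.2.1, -x.1 - x.2.1 - x.2.2)
  left_inv x := by ext <;> simp
  right_inv x := by ext <;> simp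

/-- A function of four frequencies of sum zero, evaluated on the first three of them. -/
def onSumZero {R : Type*} (F : ℤ → ℤ → ℤ → ℤ → R) (x : ℤ × ℤ × ℤ) : R :=
  F x.1 x.2.1 x.2.2 (-x.1 - x.2.1 - x.2.2)

section onSumZero

variable {R : Type*} [AddCommMonoid R] [TopologicalSpace R] {F : ℤ → ℤ → ℤ → ℤ → R} {s : R}

lemma hasSum_swap12 (h : HasSum (onSumZero F) s) :
    HasSum (onSumZero fun m p q r => F p m q r) s := by
  convert swapFst.hasSum_iff.mpr h using 1
  funext x
  simp only [onSumZero, swapFst, Function.comp, Equiv.coe_fn_mk]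
  congr 1
  ring

lemma hasSum_swap23 (h : HasSum (onSumZero F) s) :
    HasSum (onSumZero fun m p q r => F m q p r) s := by
  convert swapSnd.hasSum_iff.mpr h using 1
  funext x
  simp only [onSumZero, swapSnd, Function.comp, Equiv.coe_fn_mk]
  congr 1
  ring

lemma hasSum_swap34 (h : HasSum (onSumZero F) s) :
    HasSum (onSumZero fun m p q r => F m p r q) s := by
  convert swapLast.hasSum_iff.mpr h using 1
  funext x
  simp only [onSumZero, swapLast, Function.comp, Equiv.coe_fn_mk]
  congr 1
  ring

end onSumZero

/-- The symbol dominating the symmetrized `Ḣ³` energy. -/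
def pairSymbol (b d : ℤ → ℝ) (m p q r : ℤ) : ℝ :=
  b m * b p * d q * d r + b m * b q * d p * d r + b m * b r * d p * d q +
    b p * b q * d m * d r + b p * b r * d m * d q + b q * b r * d m * d p

/-- By `2 b_m b_p ≤ b_m² + b_p²`, each resulting term involves only three of the four frequencies.
The constraint of zero sum eliminates the fourth, so the triple sum factors as `Y * A * A`. -/
lemma hasSum_pair {b d : ℤ → ℝ} {Y A : ℝ} (hb : ∀ k, 0 ≤ b k) (hd : ∀ k, 0 ≤ d k)
    (hY : HasSum (fun k => b k ^ 2) Y) (hA : HasSum d A) :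
    ∃ w ≤ Y * A ^ 2, HasSum (onSumZero fun m p q r => b m * b p * d q * d r) w := by
  have h1 : HasSum (onSumZero fun m p q _ => b m ^ 2 * (d p * d q)) (Y * (A * A)) := by
    have h2 := hA.summable.mul_of_nonneg hA.summable hd hd
    exact hY.mul (hA.mul hA h2) (hY.summable.mul_of_nonneg h2 (fun k => sq_nonneg _)
      (fun x => mul_nonneg (hd _) (hd _)))
  have h2 := hasSum_swap23 (hasSum_swap34 h1)
  have h3 := hasSum_swap12 h2
  have h4 := (h2.add h3).mul_left (1 / 2)
  have hle : ∀ x, onSumZero (fun m p q r => b m * b p * d q * d r) x ≤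
      1 / 2 * (onSumZero (fun m _ q r => b m ^ 2 * (d q * d r)) x
        + onSumZero (fun _ p q r => b p ^ 2 * (d q * d r)) x) := by
    intro x
    simp only [onSumZero]
    have := mul_nonneg (sq_nonneg (b x.1 - b x.2.1))
      (mul_nonneg (hd x.2.2) (hd (-x.1 - x.2.1 - x.2.2)))
    nlinarith
  have hs : Summable (onSumZero fun m p q r => b m * b p * d q * d r) := by
    refine Summable.of_nonneg_of_le (fun x => ?_) hle (h4.summable.congr fun x => ?_)
    · simp only [onSumZero]
      exact mul_nonneg (mul_nonneg (mul_nonneg (hb _) (hb _)) (hd _)) (hd _)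
    · simp only [onSumZero]
  refine ⟨_, ?_, hs.hasSum⟩
  refine (hasSum_le hle hs.hasSum h4).trans (le_of_eq ?_)
  ring

lemma hasSum_pairSymbol {b d : ℤ → ℝ} {Y A : ℝ} (hb : ∀ k, 0 ≤ b k) (hd : ∀ k, 0 ≤ d k)
    (hY : HasSum (fun k => b k ^ 2) Y) (hA : HasSum d A) :
    ∃ w ≤ 6 * (Y * A ^ 2), HasSum (onSumZero (pairSymbol b d)) w := by
  obtain ⟨w, hw, h12⟩ := hasSum_pair hb hd hY hA
  have h13 := hasSum_swap23 h12
  have h14 := hasSum_swap34 h13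
  have h23 := hasSum_swap12 h13
  have h24 := hasSum_swap12 h14
  have h34 := hasSum_swap23 h24
  refine ⟨w + w + w + w + w + w, by linarith, ?_⟩
  exact ((((h12.add h13).add h14).add h23).add h24).add h34

/-- Odd weights whose increments are controlled by those of `k ↦ k ^ 7`. -/
structure IsTame (f : ℤ → ℝ) : Prop where
  odd : ∀ k, f (-k) = -f k
  lip : ∀ k l : ℤ, |f k - f l| ≤ 8 * |(k : ℝ) - l| * max |(k : ℝ)| |(l : ℝ)| ^ 6

/-- The symbol of `pairSymbol` for `Ḣ³` and `Ḣ¹`. -/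
abbrev pairWeight : ℤ → ℤ → ℤ → ℤ → ℝ :=
  pairSymbol (fun k => |(k : ℝ)| ^ 3) (fun k => |(k : ℝ)|)

/-- Oddness turns `f m + f p` into an increment of `f` over `|m + p|`, and zero sum makes this `|q +
r|`, a low-frequency quantity. As `q` and `r` are nonzero integers, `|q + r| ≤ 2|q||r|`; as the two
largest frequencies are comparable, `|m| ≤ 3|p|`, the factor `|m|⁶` splits into `|m|³` and `27|p|³`.
-/
lemma IsTame.symbol_le_of_sorted {f : ℤ → ℝ} (hf : IsTame f) {m p q r : ℤ} (hs : m + p + q + r = 0)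
    (hq : q ≠ 0) (hr : r ≠ 0) (h1 : |(p : ℝ)| ≤ |(m : ℝ)|) (h2 : |(q : ℝ)| ≤ |(p : ℝ)|)
    (h3 : |(r : ℝ)| ≤ |(p : ℝ)|) :
    |f m + f p + f q + f r| ≤ 448 * pairWeight m p q r := by
  have hs' : (m : ℝ) + p + q + r = 0 := by exact_mod_cast hs
  have hq1 : 1 ≤ |(q : ℝ)| := by exact_mod_cast Int.one_le_abs hq
  have hr1 : 1 ≤ |(r : ℝ)| := by exact_mod_cast Int.one_le_abs hr
  have e1 : |f m + f p| ≤ 8 * |(m : ℝ) + p| * |(m : ℝ)| ^ 6 := by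
    have := hf.lip m (-p)
    rw [hf.odd] at this
    simpa [abs_neg, max_eq_left h1] using this
  have e2 : |f q + f r| ≤ 8 * |(q : ℝ) + r| * |(p : ℝ)| ^ 6 := by
    have := hf.lip q (-r)
    rw [hf.odd] at this
    simp only [sub_neg_eq_add, Int.cast_neg, abs_neg] at this
    refine this.trans ?_
    gcongr
    exact max_le h2 h3
  have hmp : |(m : ℝ) + p| = |(q : ℝ) + r| := by
    rw [show (m : ℝ) + p = -(q + r) by linarith, abs_neg]
  have hqr : |(q : ℝ) + r| ≤ 2 * (|(q : ℝ)| * |(r : ℝ)|) := by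
    have := abs_add_le (q : ℝ) r
    nlinarith
  have hm3 : |(m : ℝ)| ≤ 3 * |(p : ℝ)| := by
    have := abs_add_le (p : ℝ) (q + r)
    have h' := abs_add_le (q : ℝ) r
    rw [show (m : ℝ) = -(p + (q + r)) by linarith, abs_neg]
    linarith
  rw [hmp] at e1
  set M := |(m : ℝ)|
  set P := |(p : ℝ)|
  set Q := |(q : ℝ)|
  set R := |(r : ℝ)|
  have hM : 0 ≤ M := abs_nonneg _
  have hP : 0 ≤ P := abs_nonneg _
  have e1' : |f m + f p| ≤ 432 * (M ^ 3 * P ^ 3 * Q * R) := by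
    calc |f m + f p| ≤ 8 * |(q : ℝ) + r| * M ^ 6 := e1
      _ = 8 * |(q : ℝ) + r| * (M ^ 3 * M ^ 3) := by ring
      _ ≤ 8 * (2 * (Q * R)) * (M ^ 3 * (3 * P) ^ 3) := by gcongr
      _ = _ := by ring
  have e2' : |f q + f r| ≤ 16 * (M ^ 3 * P ^ 3 * Q * R) := by
    calc |f q + f r| ≤ 8 * |(q : ℝ) + r| * P ^ 6 := e2
      _ = 8 * |(q : ℝ) + r| * (P ^ 3 * P ^ 3) := by ring
      _ ≤ 8 * (2 * (Q * R)) * (M ^ 3 * P ^ 3) := by gcongr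
      _ = _ := by ring
  have e3 : M ^ 3 * P ^ 3 * Q * R ≤ pairWeight m p q r := by
    have : pairWeight m p q r = M ^ 3 * P ^ 3 * Q * R + (M ^ 3 * Q ^ 3 * P * R +
      M ^ 3 * R ^ 3 * P * Q + P ^ 3 * Q ^ 3 * M * R + P ^ 3 * R ^ 3 * M * Q +
      Q ^ 3 * R ^ 3 * M * P) := by simp only [pairWeight, pairSymbol, M, P, Q, R]; ring
    rw [this]
    have : 0 ≤ Q := by linarith
    have : 0 ≤ R := by linarith
    have : 0 ≤ M ^ 3 * Q ^ 3 * P * R +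
      M ^ 3 * R ^ 3 * P * Q + P ^ 3 * Q ^ 3 * M * R + P ^ 3 * R ^ 3 * M * Q +
      Q ^ 3 * R ^ 3 * M * P := by positivity
    linarith
  have := abs_add_le (f m + f p) (f q + f r)
  rw [show f m + f p + f q + f r = f m + f p + (f q + f r) by ring]
  linarith

/-- `pairWeight` sums over all six pairs precisely so that it is symmetric, which allows the
frequencies to be sorted. -/
lemma IsTame.symbol_le_of_max {f : ℤ → ℝ} (hf : IsTame f) {m p q r : ℤ} (hs : m + p + q + r = 0)
    (hp : p ≠ 0) (hq : q ≠ 0) (hr : r ≠ 0) (h1 : |(p : ℝ)| ≤ |(m : ℝ)|)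
    (h2 : |(q : ℝ)| ≤ |(m : ℝ)|) (h3 : |(r : ℝ)| ≤ |(m : ℝ)|) :
    |f m + f p + f q + f r| ≤ 448 * pairWeight m p q r := by
  have key : ∀ p q r : ℤ, m + p + q + r = 0 → q ≠ 0 → r ≠ 0 → |(p : ℝ)| ≤ |(m : ℝ)| →
      |(q : ℝ)| ≤ |(p : ℝ)| → |(r : ℝ)| ≤ |(p : ℝ)| → 
      |f m + f p + f q + f r| ≤ 448 * pairWeight m p q r :=
    fun p q r h => hf.symbol_le_of_sorted h
  have hpq : |f m + f q + f p + f r| = |f m + f p + f q + f r| := by congr 1; ring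
  have hpq' : pairWeight m q p r = pairWeight m p q r := by
    simp only [pairWeight, pairSymbol]; ring
  have hrp : |f m + f r + f p + f q| = |f m + f p + f q + f r| := by congr 1; ring
  have hrp' : pairWeight m r p q = pairWeight m p q r := by
    simp only [pairWeight, pairSymbol]; ring
  rcases le_total |(q : ℝ)| |(p : ℝ)| with a | a
  · rcases le_total |(r : ℝ)| |(p : ℝ)| with b | b
    · exact key p q r hs hq hr h1 a b
    · rw [← hrp, ← hrp']
      exact key r p q (by omega) hp hq h3 b (a.trans b)
  · rcases le_total |(r : ℝ)| |(q : ℝ)| with b | b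
    · rw [← hpq, ← hpq']
      exact key q p r (by omega) hp hr h2 a b
    · rw [← hrp, ← hrp']
      exact key r p q (by omega) hp hq h3 (a.trans b) b

lemma IsTame.symbol_le {f : ℤ → ℝ} (hf : IsTame f) {m p q r : ℤ} (hs : m + p + q + r = 0)
    (hm : m ≠ 0) (hp : p ≠ 0) (hq : q ≠ 0) (hr : r ≠ 0) :
    |f m + f p + f q + f r| ≤ 448 * pairWeight m p q r := by
  have hmp : |f p + f m + f q + f r| = |f m + f p + f q + f r| := by congr 1; ring
  have hmp' : pairWeight p m q r = pairWeight m p q r := by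
    simp only [pairWeight, pairSymbol]; ring
  have hqr : |f q + f r + f m + f p| = |f m + f p + f q + f r| := by congr 1; ring
  have hqr' : pairWeight q r m p = pairWeight m p q r := by
    simp only [pairWeight, pairSymbol]; ring
  have hrq : |f r + f q + f m + f p| = |f m + f p + f q + f r| := by congr 1; ring
  have hrq' : pairWeight r q m p = pairWeight m p q r := by
    simp only [pairWeight, pairSymbol]; ring
  rcases le_total |(p : ℝ)| |(m : ℝ)| with a | a <;> rcases le_total |(r : ℝ)| |(q : ℝ)| with b | b
  · rcases le_total |(q : ℝ)| |(m : ℝ)| with c | c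
    · exact hf.symbol_le_of_max hs hp hq hr a c (b.trans c)
    · rw [← hqr, ← hqr']
      exact hf.symbol_le_of_max (by omega) hr hm hp b c (a.trans c)
  · rcases le_total |(r : ℝ)| |(m : ℝ)| with c | c
    · exact hf.symbol_le_of_max hs hp hq hr a (b.trans c) c
    · rw [← hrq, ← hrq']
      exact hf.symbol_le_of_max (by omega) hq hm hp b c (a.trans c)
  · rcases le_total |(q : ℝ)| |(p : ℝ)| with c | c
    · rw [← hmp, ← hmp']
      exact hf.symbol_le_of_max (by omega) hm hq hr a c (b.trans c)
    · rw [← hqr, ← hqr']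
      exact hf.symbol_le_of_max (by omega) hr hm hp b (a.trans c) c
  · rcases le_total |(r : ℝ)| |(p : ℝ)| with c | c
    · rw [← hmp, ← hmp']
      exact hf.symbol_le_of_max (by omega) hm hq hr a (b.trans c) c
    · rw [← hrq, ← hrq']
      exact hf.symbol_le_of_max (by omega) hq hm hp b (a.trans c) c

lemma norm_le_tsum {a : ℤ → ℂ} (hs : Summable fun k => ‖a k‖) (k : ℤ) : ‖a k‖ ≤ ∑' k, ‖a k‖ :=
  hs.le_tsum k fun _ _ => norm_nonneg _

lemma summable_conv3 {a : ℤ → ℂ} (hs : Summable fun k => ‖a k‖) (k : ℤ) :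
    Summable fun p : ℤ × ℤ => a p.1 * a p.2 * a (k - p.1 - p.2) := by
  refine Summable.of_norm_bounded
    ((hs.mul_of_nonneg hs (fun _ => norm_nonneg _) (fun _ => norm_nonneg _)).mul_right
      (∑' k, ‖a k‖)) fun p => ?_
  rw [norm_mul, norm_mul]
  gcongr
  exact norm_le_tsum hs _

/-- Symmetrization of the energy of the cubic nonlinearity. -/
lemma hasSum_energy {a : ℤ → ℂ} (ha : IsRealSeq a) (hs : Summable fun k => ‖a k‖) {f : ℤ → ℝ}
    (hodd : ∀ k, f (-k) = -f k) (hf : Summable fun k => |f k| * ‖a k‖) :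
    HasSum (onSumZero fun m p q r => ((f m + f p + f q + f r : ℝ) : ℂ) * (a m * a p * a q * a r))
      (-4 * ∑' k, (f k : ℂ) * starRingEnd ℂ (a k) * conv3 a k) := by
  set G : ℤ → ℤ → ℤ → ℤ → ℂ := fun m p q r => (f m : ℂ) * (a m * a p * a q * a r) with hG
  have hsum : Summable (onSumZero G) := by
    refine Summable.of_norm_bounded ((hf.mul_of_nonneg
      (hs.mul_of_nonneg hs (fun _ => norm_nonneg _) (fun _ => norm_nonneg _))
      (fun _ => by positivity) (fun _ => by positivity)).mul_right (∑' k, ‖a k‖)) fun x => ?_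
    simp only [onSumZero, hG, norm_mul, Complex.norm_real, Real.norm_eq_abs]
    calc _ = |f x.1| * ‖a x.1‖ * (‖a x.2.1‖ * ‖a x.2.2‖) * ‖a (-x.1 - x.2.1 - x.2.2)‖ := by ring
      _ ≤ _ := by gcongr; exact norm_le_tsum hs _
  have h1 := hsum.hasSum
  have h2 := hasSum_swap12 h1
  have h3 := hasSum_swap23 h2
  have h4 := hasSum_swap34 h3
  -- Put `m = -k`: reality of the sequence gives the conjugate of `a k`, and oddness of `f` the
  -- minus sign.
  have hT : ∑' x, onSumZero G x = -∑' k, (f k : ℂ) * starRingEnd ℂ (a k) * conv3 a k := by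
    rw [hsum.tsum_prod' (fun m => hsum.prod_factor m), ← (Equiv.neg ℤ).tsum_eq, ← tsum_neg]
    refine tsum_congr fun k => ?_
    rw [conv3, ← tsum_mul_left, ← tsum_neg]
    refine tsum_congr fun p => ?_
    simp only [onSumZero, hG, Equiv.neg_apply, hodd, ha.neg, neg_neg]
    push_cast
    ring
  rw [hT] at h1 h2 h3 h4
  convert ((h1.add h2).add h3).add h4 using 1
  · funext x
    simp only [onSumZero, hG]
    push_cast
    ring
  · ring

/-- Conservation of the `L²` norm by the nonlinearity. -/
lemma energy_id_eq_zero {a : ℤ → ℂ} (ha : IsRealSeq a) (hs : Summable fun k => ‖a k‖)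
    (hf : Summable fun k : ℤ => |(k : ℝ)| * ‖a k‖) :
    ∑' k : ℤ, (k : ℂ) * starRingEnd ℂ (a k) * conv3 a k = 0 := by
  have h := hasSum_energy ha hs (f := fun k => (k : ℝ)) (by simp) hf
  have h0 : (onSumZero fun m p q r : ℤ => (((m : ℝ) + p + q + r : ℝ) : ℂ) * (a m * a p * a q * a r))
      = 0 := by
    funext x
    simp [onSumZero]
  rw [h0] at h
  have := h.unique hasSum_zero
  simpa using this

lemma IsRealSeq.summable_norm {a : ℤ → ℂ} (ha : IsRealSeq a)
    (hf : Summable fun k : ℤ => |(k : ℝ)| * ‖a k‖) : Summable fun k => ‖a k‖ := by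
  refine Summable.of_nonneg_of_le (fun _ => norm_nonneg _) (fun k => ?_) hf
  rcases eq_or_ne k 0 with rfl | hk
  · simp [ha.zero]
  · have : (1 : ℝ) ≤ |(k : ℝ)| := by exact_mod_cast Int.one_le_abs hk
    nlinarith [norm_nonneg (a k)]

/-- The energy estimate for the nonlinearity, with no loss of derivatives. -/
lemma IsTame.norm_energy_le {f : ℤ → ℝ} (hf : IsTame f) {a : ℤ → ℂ} (ha : IsRealSeq a) {Y A : ℝ}
    (hfa : Summable fun k => |f k| * ‖a k‖)
    (hY : HasSum (fun k : ℤ => |(k : ℝ)| ^ 6 * ‖a k‖ ^ 2) Y)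
    (hA : HasSum (fun k : ℤ => |(k : ℝ)| * ‖a k‖) A) :
    ‖∑' k, (f k : ℂ) * starRingEnd ℂ (a k) * conv3 a k‖ ≤ 672 * (Y * A ^ 2) := by
  have hs := ha.summable_norm hA.summable
  have h := hasSum_energy ha hs hf.odd hfa
  obtain ⟨w, hw, hW⟩ := hasSum_pairSymbol (b := fun k : ℤ => |(k : ℝ)| ^ 3 * ‖a k‖)
    (d := fun k : ℤ => |(k : ℝ)| * ‖a k‖) (fun _ => by positivity) (fun _ => by positivity)
    (Y := Y) (A := A) (by convert hY using 2; ring) hA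
  have hle : ∀ x, ‖onSumZero (fun m p q r =>
      ((f m + f p + f q + f r : ℝ) : ℂ) * (a m * a p * a q * a r)) x‖ ≤
      448 * onSumZero (pairSymbol (fun k : ℤ => |(k : ℝ)| ^ 3 * ‖a k‖)
        (fun k : ℤ => |(k : ℝ)| * ‖a k‖)) x := by
    rintro ⟨m, p, q⟩
    simp only [onSumZero]
    set r := -m - p - q with hr
    have e : pairSymbol (fun k : ℤ => |(k : ℝ)| ^ 3 * ‖a k‖) (fun k : ℤ => |(k : ℝ)| * ‖a k‖) m p q r
        = pairWeight m p q r * (‖a m‖ * ‖a p‖ * ‖a q‖ * ‖a r‖) := by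
      simp only [pairWeight, pairSymbol]
      ring
    rw [e, norm_mul, Complex.norm_real, Real.norm_eq_abs]
    simp only [norm_mul]
    by_cases h0 : m = 0 ∨ p = 0 ∨ q = 0 ∨ r = 0
    · have : ‖a m‖ * ‖a p‖ * ‖a q‖ * ‖a r‖ = 0 := by
        rcases h0 with h | h | h | h <;> simp [h, ha.zero]
      simp [this]
    · push Not at h0
      have hsum : m + p + q + r = 0 := by omega
      exact (mul_le_mul_of_nonneg_right (hf.symbol_le hsum h0.1 h0.2.1 h0.2.2.1 h0.2.2.2)
        (by positivity)).trans_eq (mul_assoc _ _ _)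
  -- The six pairs and the fourfold symmetrization give `448 * 6 / 4 = 672`.
  have h6 : ‖-4 * ∑' k, (f k : ℂ) * starRingEnd ℂ (a k) * conv3 a k‖ ≤ 448 * w := by
    rw [← h.tsum_eq]
    exact tsum_of_norm_bounded (hW.mul_left 448) hle
  rw [norm_mul] at h6
  norm_num at h6
  linarith

end

/-! ## Weights -/

lemma isTame_pow : IsTame fun k => (k : ℝ) ^ 7 where
  odd k := by push_cast; ring
  lip k l := by
    refine (abs_pow_sub_pow_le ..).trans ?_
    have : 0 ≤ |(k : ℝ) - l| * max |(k : ℝ)| |(l : ℝ)| ^ 6 := by positivity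
    norm_num
    linarith

/-- A Lipschitz cutoff at frequency `n`. -/
def cutoff (n : ℕ) (k : ℤ) : ℝ := max 0 (1 - |(k : ℝ)| / n)

lemma cutoff_nonneg (n : ℕ) (k : ℤ) : 0 ≤ cutoff n k := le_max_left _ _

lemma cutoff_le_one (n : ℕ) (k : ℤ) : cutoff n k ≤ 1 :=
  max_le zero_le_one (sub_le_self _ (by positivity))

lemma cutoff_neg (n : ℕ) (k : ℤ) : cutoff n (-k) = cutoff n k := by simp [cutoff]

lemma cutoff_eq_zero {n : ℕ} (hn : n ≠ 0) {k : ℤ} (hk : (n : ℝ) ≤ |(k : ℝ)|) : cutoff n k = 0 := by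
  have : (0 : ℝ) < n := by positivity
  exact max_eq_left (sub_nonpos.mpr ((one_le_div this).mpr hk))

lemma cutoff_sub_le {n : ℕ} (k l : ℤ) : |cutoff n k - cutoff n l| ≤ |(k : ℝ) - l| / n := by
  have h := abs_max_sub_max_le_abs (1 - |(k : ℝ)| / n) (1 - |(l : ℝ)| / n) 0
  rw [max_comm _ 0, max_comm _ 0] at h
  refine h.trans ?_
  rw [show 1 - |(k : ℝ)| / n - (1 - |(l : ℝ)| / n) = (|(l : ℝ)| - |(k : ℝ)|) / n by ring, abs_div,
    Nat.abs_cast]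
  refine div_le_div_of_nonneg_right ?_ n.cast_nonneg
  rw [abs_sub_comm (k : ℝ)]
  exact abs_abs_sub_abs_le _ _

lemma tendsto_cutoff (k : ℤ) : Tendsto (fun n => cutoff n k) atTop (𝓝 1) := by
  have h : Tendsto (fun n : ℕ => |(k : ℝ)| / n) atTop (𝓝 0) := tendsto_const_div_atTop_nhds_zero_nat _
  have := (tendsto_const_nhds (x := (0 : ℝ))).max (h.const_sub 1)
  simpa [cutoff] using this

/-- Product rule: `k⁷` contributes 7 and the cutoff 1, which explains the 8 in `IsTame`. The slope
`1/n` of the cutoff is harmless because either both cutoff values vanish or `|l| ≤ n`; the bound is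
thus uniform in `n`. -/
lemma isTame_cutoff {n : ℕ} (hn : n ≠ 0) : IsTame fun k => (k : ℝ) ^ 7 * cutoff n k where
  odd k := by rw [cutoff_neg]; push_cast; ring
  lip := by
    have key : ∀ k l : ℤ, |(l : ℝ)| ≤ |(k : ℝ)| →
        |(k : ℝ) ^ 7 * cutoff n k - (l : ℝ) ^ 7 * cutoff n l| ≤
          8 * |(k : ℝ) - l| * max |(k : ℝ)| |(l : ℝ)| ^ 6 := by
      intro k l hkl
      rw [max_eq_left hkl]
      have e1 : |(k : ℝ) ^ 7 - (l : ℝ) ^ 7| ≤ 7 * |(k : ℝ) - l| * |(k : ℝ)| ^ 6 := by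
        refine (abs_pow_sub_pow_le ..).trans (le_of_eq ?_)
        simp only [max_eq_left hkl, Nat.reduceSub, Nat.cast_ofNat]
        ring
      have e2 : |(l : ℝ)| ^ 7 * |cutoff n k - cutoff n l| ≤ |(k : ℝ) - l| * |(k : ℝ)| ^ 6 := by
        rcases le_total (n : ℝ) |(l : ℝ)| with h | h
        · rw [cutoff_eq_zero hn h, cutoff_eq_zero hn (h.trans hkl)]
          simp only [sub_self, abs_zero, mul_zero]
          positivity
        · have hn' : (0 : ℝ) < n := by positivity
          calc |(l : ℝ)| ^ 7 * |cutoff n k - cutoff n l|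
              ≤ |(l : ℝ)| ^ 7 * (|(k : ℝ) - l| / n) := by gcongr; exact cutoff_sub_le k l
            _ = |(l : ℝ)| ^ 6 * |(k : ℝ) - l| * (|(l : ℝ)| / n) := by ring
            _ ≤ |(k : ℝ)| ^ 6 * |(k : ℝ) - l| * 1 := by
              gcongr
              exact (div_le_one hn').mpr h
            _ = _ := by ring
      have e3 : |((k : ℝ) ^ 7 - (l : ℝ) ^ 7) * cutoff n k| ≤ 7 * |(k : ℝ) - l| * |(k : ℝ)| ^ 6 := by
        rw [abs_mul, abs_of_nonneg (cutoff_nonneg n k)]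
        exact (mul_le_of_le_one_right (abs_nonneg _) (cutoff_le_one n k)).trans e1
      have e4 := abs_add_le (((k : ℝ) ^ 7 - (l : ℝ) ^ 7) * cutoff n k)
        ((l : ℝ) ^ 7 * (cutoff n k - cutoff n l))
      rw [abs_mul ((l : ℝ) ^ 7), abs_pow] at e4
      rw [show (k : ℝ) ^ 7 * cutoff n k - (l : ℝ) ^ 7 * cutoff n l =
        ((k : ℝ) ^ 7 - (l : ℝ) ^ 7) * cutoff n k + (l : ℝ) ^ 7 * (cutoff n k - cutoff n l) by ring]
      linarith
    intro k l
    rcases le_total |(l : ℝ)| |(k : ℝ)| with h | h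
    · exact key k l h
    · rw [abs_sub_comm, abs_sub_comm (k : ℝ), max_comm]
      exact key l k h

/-! ## Decay of the cubic convolution -/

/-- Polynomial decay of order `s`. -/
def wt (s : ℕ) (k : ℤ) : ℝ := ((1 + |(k : ℝ)|) ^ s)⁻¹

lemma wt_pos (s : ℕ) (k : ℤ) : 0 < wt s k := by unfold wt; positivity

lemma wt_le_one (s : ℕ) (k : ℤ) : wt s k ≤ 1 :=
  inv_le_one_of_one_le₀ (one_le_pow₀ (by linarith [abs_nonneg (k : ℝ)]))

lemma wt_anti {s t : ℕ} (h : s ≤ t) (k : ℤ) : wt t k ≤ wt s k := by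
  unfold wt
  have : (1 : ℝ) ≤ 1 + |(k : ℝ)| := by linarith [abs_nonneg (k : ℝ)]
  gcongr

lemma abs_mul_wt_succ_le (s : ℕ) (k : ℤ) : |(k : ℝ)| * wt (s + 1) k ≤ wt s k := by
  unfold wt
  have : 0 < 1 + |(k : ℝ)| := by positivity
  rw [pow_succ, mul_inv, mul_left_comm]
  refine mul_le_of_le_one_right (by positivity) ?_
  rw [← div_eq_mul_inv, div_le_one this]
  linarith

lemma summable_wt {s : ℕ} (hs : 2 ≤ s) : Summable (wt s) := by
  have h2 : Summable fun n : ℕ => ((1 + (n : ℝ)) ^ s)⁻¹ := by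
    have := (summable_nat_add_iff 1).mpr (Real.summable_nat_pow_inv.mpr (show 1 < s by omega))
    refine this.congr fun n => ?_
    push_cast
    rw [add_comm]
  exact Summable.of_nat_of_neg (by simpa [wt] using h2) (by simpa [wt] using h2)

lemma wt_le_of_abs_le {k p : ℤ} (h : |(k : ℝ)| ≤ 3 * |(p : ℝ)|) : wt 3 p ≤ 27 * wt 3 k := by
  unfold wt
  have hk : 0 < 1 + |(k : ℝ)| := by positivity
  have hp : 0 < 1 + |(p : ℝ)| := by positivity
  rw [← div_eq_mul_inv, ← one_div, div_le_div_iff₀ (by positivity) (by positivity)]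
  calc 1 * (1 + |(k : ℝ)|) ^ 3 ≤ 1 * (3 * (1 + |(p : ℝ)|)) ^ 3 := by gcongr; linarith
    _ = _ := by ring

/-- One of the three frequencies carries at least a third of `|k|`, so its weight can be exchanged
for `27 * wt 3 k`. -/
lemma wt_mul_mul_le {k p q r : ℤ} (h : k = p + q + r) :
    wt 3 p * wt 3 q * wt 3 r ≤
      27 * wt 3 k * (wt 3 p * wt 3 q + wt 3 p * wt 3 r + wt 3 q * wt 3 r) := by
  have hk : |(k : ℝ)| ≤ |(p : ℝ)| + |(q : ℝ)| + |(r : ℝ)| := by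
    rw [h]
    push_cast
    exact abs_add_three _ _ _
  have hp := wt_pos 3 p
  have hq := wt_pos 3 q
  have hr := wt_pos 3 r
  have hk' := wt_pos 3 k
  have : |(k : ℝ)| ≤ 3 * |(p : ℝ)| ∨ |(k : ℝ)| ≤ 3 * |(q : ℝ)| ∨ |(k : ℝ)| ≤ 3 * |(r : ℝ)| := by
    by_contra! hc
    linarith [hc.1, hc.2.1, hc.2.2]
  have h1 := mul_pos hk' (mul_pos hp hq)
  have h2 := mul_pos hk' (mul_pos hp hr)
  have h3 := mul_pos hk' (mul_pos hq hr)
  rcases this with h | h | h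
  · nlinarith [mul_le_mul_of_nonneg_right (wt_le_of_abs_le h) (mul_pos hq hr).le]
  · nlinarith [mul_le_mul_of_nonneg_right (wt_le_of_abs_le h) (mul_pos hp hr).le]
  · nlinarith [mul_le_mul_of_nonneg_right (wt_le_of_abs_le h) (mul_pos hp hq).le]

/-- Two of three frequencies of sum `k`. -/
def complEquiv (k : ℤ) : ℤ × ℤ ≃ ℤ × ℤ where
  toFun p := (p.1, k - p.1 - p.2)
  invFun p := (p.1, k - p.1 - p.2)
  left_inv p := by ext <;> simp
  right_inv p := by ext <;> simp

/-- The mass of `wt s`. -/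
def wtSum (s : ℕ) : ℝ := ∑' k, wt s k

lemma hasSum_wt_mul {s : ℕ} (hs : 2 ≤ s) :
    HasSum (fun p : ℤ × ℤ => wt s p.1 * wt s p.2) (wtSum s ^ 2) := by
  have h := (summable_wt hs).hasSum
  rw [sq]
  exact h.mul h ((summable_wt hs).mul_of_nonneg (summable_wt hs)
    (fun k => (wt_pos s k).le) (fun k => (wt_pos s k).le))

lemma norm_conv3_le_of_decay {a : ℤ → ℂ} {M : ℝ} (h : ∀ k, ‖a k‖ ≤ M * wt 3 k) (k : ℤ) :
    ‖conv3 a k‖ ≤ 81 * M ^ 3 * wtSum 3 ^ 2 * wt 3 k := by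
  have hM : 0 ≤ M := by
    have := (norm_nonneg _).trans (h 0)
    exact nonneg_of_mul_nonneg_left this (wt_pos 3 0)
  have h1 := hasSum_wt_mul (s := 3) (by norm_num)
  have h2 := (complEquiv k).hasSum_iff.mpr h1
  have h3 := (Equiv.prodComm ℤ ℤ).hasSum_iff.mpr h2
  have hall := ((h1.add h2).add h3).mul_left (M ^ 3 * (27 * wt 3 k))
  rw [show 81 * M ^ 3 * wtSum 3 ^ 2 * wt 3 k = M ^ 3 * (27 * wt 3 k) *
    (wtSum 3 ^ 2 + wtSum 3 ^ 2 + wtSum 3 ^ 2) by ring]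
  refine tsum_of_norm_bounded hall fun p => ?_
  have hw := wt_mul_mul_le (show k = p.1 + p.2 + (k - p.1 - p.2) by ring)
  have e : wt 3 (k - p.1 - p.2) = wt 3 (k - p.2 - p.1) := by congr 1; ring
  simp only [Function.comp, complEquiv, Equiv.coe_fn_mk, Equiv.prodComm_apply, Prod.fst_swap,
    Prod.snd_swap, norm_mul]
  calc ‖a p.1‖ * ‖a p.2‖ * ‖a (k - p.1 - p.2)‖
      ≤ (M * wt 3 p.1) * (M * wt 3 p.2) * (M * wt 3 (k - p.1 - p.2)) := by
        have := wt_pos 3 p.1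
        have := wt_pos 3 p.2
        gcongr <;> exact h _
    _ = M ^ 3 * (wt 3 p.1 * wt 3 p.2 * wt 3 (k - p.1 - p.2)) := by ring
    _ ≤ M ^ 3 * (27 * wt 3 k * (wt 3 p.1 * wt 3 p.2 + wt 3 p.1 * wt 3 (k - p.1 - p.2) +
          wt 3 p.2 * wt 3 (k - p.1 - p.2))) := by
        exact mul_le_mul_of_nonneg_left hw (pow_nonneg hM 3)
    _ = _ := by rw [← e]; ring

lemma summable_norm_of_decay {a : ℤ → ℂ} {M : ℝ} (h : ∀ k, ‖a k‖ ≤ M * wt 2 k) :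
    Summable fun k => ‖a k‖ :=
  Summable.of_nonneg_of_le (fun _ => norm_nonneg _) h ((summable_wt le_rfl).mul_left M)

/-- Telescoping of the cube. Two of the three factors keep their summable weights; the third is
bounded uniformly. -/
lemma norm_conv3_sub_le {a b : ℤ → ℂ} {M δ : ℝ} (ha : ∀ k, ‖a k‖ ≤ M * wt 2 k)
    (hb : ∀ k, ‖b k‖ ≤ M * wt 2 k) (hab : ∀ k, ‖a k - b k‖ ≤ δ * wt 2 k) (k : ℤ) :
    ‖conv3 a k - conv3 b k‖ ≤ 3 * δ * M ^ 2 * wtSum 2 ^ 2 := by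
  have hM : 0 ≤ M := nonneg_of_mul_nonneg_left ((norm_nonneg _).trans (ha 0)) (wt_pos 2 0)
  have hδ : 0 ≤ δ := nonneg_of_mul_nonneg_left ((norm_nonneg _).trans (hab 0)) (wt_pos 2 0)
  have ha' : ∀ k, ‖a k‖ ≤ M := fun k => (ha k).trans (mul_le_of_le_one_right hM (wt_le_one 2 k))
  have hab' : ∀ k, ‖a k - b k‖ ≤ δ :=
    fun k => (hab k).trans (mul_le_of_le_one_right hδ (wt_le_one 2 k))
  have hb' : ∀ k, ‖b k‖ ≤ M := fun k => (hb k).trans (mul_le_of_le_one_right hM (wt_le_one 2 k))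
  rw [conv3, conv3, ← Summable.tsum_sub (summable_conv3 (summable_norm_of_decay ha) k)
    (summable_conv3 (summable_norm_of_decay hb) k)]
  have hall := (hasSum_wt_mul (s := 2) le_rfl).mul_left (3 * δ * M ^ 2)
  refine tsum_of_norm_bounded hall fun p => ?_
  have := wt_pos 2 p.1
  have := wt_pos 2 p.2
  set r := k - p.1 - p.2
  calc ‖a p.1 * a p.2 * a r - b p.1 * b p.2 * b r‖
      = ‖(a p.1 - b p.1) * a p.2 * a r + b p.1 * (a p.2 - b p.2) * a r
          + b p.1 * b p.2 * (a r - b r)‖ := by congr 1; ring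
    _ ≤ ‖a p.1 - b p.1‖ * ‖a p.2‖ * ‖a r‖ + ‖b p.1‖ * ‖a p.2 - b p.2‖ * ‖a r‖
          + ‖b p.1‖ * ‖b p.2‖ * ‖a r - b r‖ := by
        refine (norm_add₃_le).trans (le_of_eq ?_)
        simp only [norm_mul]
    _ ≤ (δ * wt 2 p.1) * (M * wt 2 p.2) * M + (M * wt 2 p.1) * (δ * wt 2 p.2) * M
          + (M * wt 2 p.1) * (M * wt 2 p.2) * δ := by
        gcongr <;> first | exact ha _ | exact hb _ | exact hab _ | exact ha' _ | exact hab' _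
    _ = _ := by ring

lemma tendsto_conv3 {ι : Type*} {l : Filter ι} {a : ι → ℤ → ℂ} {b : ℤ → ℂ} {M : ℝ}
    (ha : ∀ᶠ i in l, ∀ k, ‖a i k‖ ≤ M * wt 2 k) (hab : ∀ k, Tendsto (fun i => a i k) l (𝓝 (b k)))
    (k : ℤ) : Tendsto (fun i => conv3 (a i) k) l (𝓝 (conv3 b k)) := by
  refine tendsto_tsum_of_dominated_convergence
    ((hasSum_wt_mul (s := 2) le_rfl).mul_left (M ^ 3)).summable
    (fun p => ((hab _).mul (hab _)).mul (hab _)) (ha.mono fun i hi p => ?_)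
  have hM : 0 ≤ M := nonneg_of_mul_nonneg_left ((norm_nonneg _).trans (hi 0)) (wt_pos 2 0)
  have := wt_pos 2 p.1
  have := wt_pos 2 p.2
  rw [norm_mul, norm_mul]
  calc _ ≤ (M * wt 2 p.1) * (M * wt 2 p.2) * M := by
        gcongr <;>
        first
        | exact hi _
        | exact (hi _).trans (mul_le_of_le_one_right hM (wt_le_one 2 _))
    _ = _ := by ring

lemma conv3_neg {a : ℤ → ℂ} (ha : IsRealSeq a) (k : ℤ) :
    conv3 a (-k) = starRingEnd ℂ (conv3 a k) := by
  unfold conv3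
  rw [Complex.conj_tsum, ← (Equiv.neg (ℤ × ℤ)).tsum_eq]
  refine tsum_congr fun p => ?_
  simp only [Equiv.neg_apply, Prod.fst_neg, Prod.snd_neg, map_mul, ← ha.neg]
  congr 2
  ring

section

/-! ## The Galerkin system -/

/-- The equation on the Fourier side. -/
def rhs (a : ℤ → ℂ) (k : ℤ) : ℂ :=
  -(Complex.I * k / 3) * conv3 a k - a k / (|(k : ℝ)| : ℝ)

lemma rhs_neg {a : ℤ → ℂ} (ha : IsRealSeq a) (k : ℤ) :
    rhs a (-k) = starRingEnd ℂ (rhs a k) := by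
  simp only [rhs, conv3_neg ha, ha.neg, Int.cast_neg, abs_neg, map_sub, map_mul, map_neg, map_div₀,
    Complex.conj_I, Complex.conj_ofReal, Complex.conj_ofNat, map_intCast]
  ring

lemma rhs_zero {a : ℤ → ℂ} (ha : IsRealSeq a) : rhs a 0 = 0 := by simp [rhs, ha.zero]

/-- The contribution of a set of frequencies to the derivative of a weighted energy. -/
lemma sum_energy (S : Finset ℤ) (g : ℤ → ℝ) (a : ℤ → ℂ) :
    ∑ k ∈ S, g k * (2 * (starRingEnd ℂ (a k) * rhs a k).re) =
      2 / 3 * (∑ k ∈ S, ((k * g k : ℝ) : ℂ) * starRingEnd ℂ (a k) * conv3 a k).im -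
        2 * ∑ k ∈ S, g k * (‖a k‖ ^ 2 / |(k : ℝ)|) := by
  rw [Complex.im_sum, Finset.mul_sum, Finset.mul_sum, ← Finset.sum_sub_distrib]
  refine Finset.sum_congr rfl fun k _ => ?_
  have e : starRingEnd ℂ (a k) * rhs a k = -Complex.I * ((k / 3 : ℝ) : ℂ) *
      (starRingEnd ℂ (a k) * conv3 a k) - ((‖a k‖ ^ 2 / |(k : ℝ)| : ℝ) : ℂ) := by
    have := Complex.conj_mul' (a k)
    simp only [rhs]
    push_cast
    rw [← this]
    ring
  rw [e]
  simp only [Complex.sub_re, Complex.ofReal_re, mul_assoc,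
    Complex.neg_re, Complex.mul_re, Complex.mul_im, Complex.neg_im,
    Complex.I_re, Complex.I_im, Complex.ofReal_im]
  ring

lemma hasDerivAt_weighted_energy {S : Finset ℤ} {g : ℤ → ℝ} {a : ℝ → ℤ → ℂ} {a' : ℤ → ℂ} {s : Set ℝ}
    {t : ℝ} (h : ∀ k ∈ S, HasDerivWithinAt (fun t => a t k) (a' k) s t) :
    HasDerivWithinAt (fun t => ∑ k ∈ S, g k * ‖a t k‖ ^ 2)
      (∑ k ∈ S, g k * (2 * (starRingEnd ℂ (a t k) * a' k).re)) s t := by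
  refine HasDerivWithinAt.fun_sum fun k hk => ?_
  have := ((h k hk).norm_sq).const_mul (g k)
  rw [Complex.inner] at this
  simpa only [mul_comm] using this

/-- Global existence for smooth compactly supported vector fields. -/
lemma exists_solution_of_hasCompactSupport {E : Type*} [NormedAddCommGroup E] [NormedSpace ℝ E]
    [CompleteSpace E] {v : E → E} (hv : ContDiff ℝ 1 v) (hc : HasCompactSupport v) (x₀ : E)
    {T : ℝ} (hT : 0 < T) :
    ∃ α : ℝ → E, α 0 = x₀ ∧ ∀ t ∈ Icc 0 T, HasDerivAt α (v (α t)) t := by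
  obtain ⟨K, hK⟩ := ContDiff.lipschitzWith_of_hasCompactSupport hc hv one_ne_zero
  obtain ⟨B, hB⟩ := hc.exists_bound_of_continuous hv.continuous
  have hB0 : 0 ≤ B := (norm_nonneg _).trans (hB x₀)
  have hT1 : (0 : ℝ) ≤ T + 1 := by linarith
  -- The field is globally Lipschitz and bounded by `B`, so a ball of radius `B * (T + 1)` is never
  -- left. The larger interval `[-1, T + 1]` makes the derivatives two-sided on `[0, T]`.
  have hpl : IsPicardLindelof (fun _ => v) (tmin := -1) (tmax := T + 1)
      ⟨0, by constructor <;> linarith⟩ x₀ (⟨B, hB0⟩ * ⟨T + 1, hT1⟩) 0 ⟨B, hB0⟩ K :=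
    { lipschitzOnWith := fun t _ => hK.lipschitzOnWith
      continuousOn := fun x _ => continuousOn_const
      norm_le := fun t _ x _ => hB x
      mul_max_le := by
        have : max (T + 1 - 0) (0 - -1) = T + 1 := by
          rw [max_eq_left] <;> linarith
        show B * max (T + 1 - 0) (0 - -1) ≤ B * (T + 1) - 0
        rw [this, sub_zero] }
  obtain ⟨α, h0, h⟩ := hpl.exists_eq_forall_mem_Icc_hasDerivWithinAt₀
  exact ⟨α, h0, fun t ht => (h t ⟨by linarith [ht.1], by linarith [ht.2]⟩).hasDerivAt
    (Icc_mem_nhds (by linarith [ht.1]) (by linarith [ht.2]))⟩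

/-- Extension of positive frequencies to a real sequence. -/
def extend (N : ℕ) (x : Finset.Icc (1 : ℤ) N → ℂ) (k : ℤ) : ℂ :=
  if h : k ∈ Finset.Icc (1 : ℤ) N then x ⟨k, h⟩
  else if h : -k ∈ Finset.Icc (1 : ℤ) N then starRingEnd ℂ (x ⟨-k, h⟩) else 0

/-- The frequencies of the Galerkin system. -/
abbrev freqs (N : ℕ) : Finset ℤ := Finset.Icc (-N : ℤ) N

variable {N : ℕ}

lemma extend_coe (x : Finset.Icc (1 : ℤ) N → ℂ) (j : Finset.Icc (1 : ℤ) N) :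
    extend N x j = x j := by simp [extend]

lemma extend_eq_zero (x : Finset.Icc (1 : ℤ) N → ℂ) {k : ℤ} (hk : k ∉ freqs N) :
    extend N x k = 0 := by
  simp only [Finset.mem_Icc] at hk
  rw [extend, dif_neg (by simp only [Finset.mem_Icc]; omega),
    dif_neg (by simp only [Finset.mem_Icc]; omega)]

lemma isRealSeq_extend (x : Finset.Icc (1 : ℤ) N → ℂ) : IsRealSeq (extend N x) where
  zero := by simp [extend]
  neg k := by
    unfold extend
    by_cases h1 : k ∈ Finset.Icc (1 : ℤ) N
    · have : -k ∉ Finset.Icc (1 : ℤ) N := by simp only [Finset.mem_Icc] at *; omega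
      simp [h1, this]
    · by_cases h2 : -k ∈ Finset.Icc (1 : ℤ) N <;> simp [h1, h2]

lemma contDiff_extend (k : ℤ) : ContDiff ℝ 1 fun x => extend N x k := by
  unfold extend
  split_ifs with h1 h2
  · fun_prop
  · exact Complex.conjCLE.contDiff.comp (contDiff_apply ℝ ℂ _)
  · exact contDiff_const

lemma conv3_eq_sum {a : ℤ → ℂ} (ha : ∀ k ∉ freqs N, a k = 0) (k : ℤ) :
    conv3 a k = ∑ p ∈ freqs N ×ˢ freqs N, a p.1 * a p.2 * a (k - p.1 - p.2) := by
  refine tsum_eq_sum fun p hp => ?_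
  rw [Finset.mem_product, not_and_or] at hp
  rcases hp with hp | hp <;> simp [ha _ hp]

/-- The total energy of the extension. -/
def energy (N : ℕ) (x : Finset.Icc (1 : ℤ) N → ℂ) : ℝ := ∑ k ∈ freqs N, 1 * ‖extend N x k‖ ^ 2

/-- The Galerkin vector field, cut off at energy `R`. -/
def galerkinField (N : ℕ) (R : ℝ) (x : Finset.Icc (1 : ℤ) N → ℂ) : Finset.Icc (1 : ℤ) N → ℂ :=
  fun j => smoothTransition (R + 1 - energy N x) • rhs (extend N x) j

lemma contDiff_energy : ContDiff ℝ 1 (energy N) :=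
  ContDiff.sum fun k _ => contDiff_const.mul ((contDiff_extend k).norm_sq ℝ)

lemma contDiff_galerkinField (R : ℝ) : ContDiff ℝ 1 (galerkinField N R) := by
  refine contDiff_pi.mpr fun j => ?_
  refine (smoothTransition.contDiff.comp (contDiff_const.sub contDiff_energy)).smul ?_
  unfold rhs
  refine (contDiff_const.mul ?_).sub ((contDiff_extend _).div_const _)
  simp_rw [conv3_eq_sum (fun k => extend_eq_zero _)]
  exact ContDiff.sum fun p _ => ((contDiff_extend _).mul (contDiff_extend _)).mul (contDiff_extend _)

lemma hasCompactSupport_galerkinField (R : ℝ) : HasCompactSupport (galerkinField N R) := by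
  refine HasCompactSupport.intro (isCompact_closedBall (0 : Finset.Icc (1 : ℤ) N → ℂ) √(|R + 1|))
    fun x hx => ?_
  rw [mem_closedBall_zero_iff, pi_norm_le_iff_of_nonneg (by positivity)] at hx
  push Not at hx
  obtain ⟨j, hj⟩ := hx
  have h1 : |R + 1| < ‖x j‖ ^ 2 := by
    have := pow_lt_pow_left₀ hj (by positivity) two_ne_zero
    rwa [sq_sqrt (abs_nonneg _)] at this
  have h2 : ‖x j‖ ^ 2 ≤ energy N x := by
    have hj' := Finset.mem_Icc.mp j.2
    have := Finset.single_le_sum (f := fun k => 1 * ‖extend N x k‖ ^ 2)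
      (fun k _ => by positivity) (show (j : ℤ) ∈ freqs N by rw [Finset.mem_Icc]; omega)
    simpa [extend_coe, energy] using this
  funext j
  rw [galerkinField, smoothTransition.zero_of_nonpos (by linarith [le_abs_self (R + 1)])]
  simp

/-- A solution on `[0, T]` of the equation projected on the frequencies `|k| ≤ N`. -/
structure IsGalerkin (N : ℕ) (T : ℝ) (a₀ : ℤ → ℂ) (a : ℝ → ℤ → ℂ) : Prop where
  real : ∀ t, IsRealSeq (a t)
  supp : ∀ t, ∀ k ∉ freqs N, a t k = 0
  init : ∀ k ∈ freqs N, a 0 k = a₀ k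
  deriv : ∀ t ∈ Icc 0 T, ∀ k ∈ freqs N, HasDerivAt (fun t => a t k) (rhs (a t) k) t

lemma summable_of_supp {a : ℤ → ℂ} (ha : ∀ k ∉ freqs N, a k = 0) {f : ℤ → ℂ → ℝ}
    (hf : ∀ k, f k 0 = 0) : Summable fun k => f k (a k) :=
  summable_of_ne_finset_zero (s := freqs N) fun k hk => by rw [ha k hk, hf]

/-- The projection costs nothing: the cube is tested against a sequence supported in the retained
frequencies, so the full `L²` cancellation applies. -/
lemma energy_rhs {a : ℤ → ℂ} (ha : IsRealSeq a) (hs : ∀ k ∉ freqs N, a k = 0) :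
    ∑ k ∈ freqs N, 1 * (2 * (starRingEnd ℂ (a k) * rhs a k).re) =
      -2 * ∑ k ∈ freqs N, 1 * (‖a k‖ ^ 2 / |(k : ℝ)|) := by
  rw [sum_energy (freqs N) (fun _ => 1)]
  have h := energy_id_eq_zero ha (summable_of_supp hs (f := fun _ z => ‖z‖) (by simp))
    (summable_of_supp hs (f := fun k z => |(k : ℝ)| * ‖z‖) (by simp))
  rw [tsum_eq_sum (s := freqs N) (fun k hk => by simp [hs k hk])] at h
  simp only [mul_one, Complex.ofReal_intCast, h]
  simp

/-- The cutoff multiplies the field by a nonnegative scalar, so the `L²` energy is nonincreasing in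
any case. It therefore stays below its initial value `R`, where the cutoff equals 1 and the true
system is solved. -/
lemma exists_isGalerkin {T : ℝ} (hT : 0 < T) {a₀ : ℤ → ℂ} (ha₀ : IsRealSeq a₀) (N : ℕ) :
    ∃ a, IsGalerkin N T a₀ a := by
  set x₀ : Finset.Icc (1 : ℤ) N → ℂ := fun j => a₀ j
  set R := energy N x₀
  obtain ⟨x, h0, hx⟩ := exists_solution_of_hasCompactSupport (contDiff_galerkinField (N := N) R)
    (hasCompactSupport_galerkinField R) x₀ hT
  set θ : ℝ → ℝ := fun t => smoothTransition (R + 1 - energy N (x t))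
  have hd : ∀ t ∈ Icc 0 T, ∀ k ∈ freqs N,
      HasDerivAt (fun t => extend N (x t) k) (θ t • rhs (extend N (x t)) k) t := by
    intro t ht k hk
    have hx' := hasDerivAt_pi.mp (hx t ht)
    by_cases h1 : k ∈ Finset.Icc (1 : ℤ) N
    · have e : (fun t => extend N (x t) k) = fun t => x t ⟨k, h1⟩ := by
        funext t; exact extend_coe (x t) ⟨k, h1⟩
      rw [e]
      exact hx' ⟨k, h1⟩
    · by_cases h2 : -k ∈ Finset.Icc (1 : ℤ) N
      · have e : (fun t => extend N (x t) k) = fun t => starRingEnd ℂ (x t ⟨-k, h2⟩) := by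
          funext t; simp [extend, h1, h2]
        rw [e]
        have := (Complex.conjCLE : ℂ →L[ℝ] ℂ).hasFDerivAt.comp_hasDerivAt t (hx' ⟨-k, h2⟩)
        refine this.congr_deriv ?_
        simp [galerkinField, rhs_neg (isRealSeq_extend _), θ]
      · have hk0 : k = 0 := by simp only [Finset.mem_Icc] at hk h1 h2; omega
        subst hk0
        have e : (fun t => extend N (x t) 0) = fun _ => 0 := by
          funext t; exact (isRealSeq_extend _).zero
        rw [e, rhs_zero (isRealSeq_extend _), smul_zero]
        exact hasDerivAt_const _ _
  have hE : ∀ t ∈ Icc 0 T, HasDerivAt (fun t => energy N (x t))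
      (θ t * (-2 * ∑ k ∈ freqs N, 1 * (‖extend N (x t) k‖ ^ 2 / |(k : ℝ)|))) t := by
    intro t ht
    have := hasDerivAt_weighted_energy (g := fun _ => 1) (s := univ)
      (fun k hk => (hd t ht k hk).hasDerivWithinAt)
    rw [hasDerivWithinAt_univ] at this
    refine this.congr_deriv ?_
    rw [← energy_rhs (isRealSeq_extend _) (fun k => extend_eq_zero _), Finset.mul_sum]
    refine Finset.sum_congr rfl fun k _ => ?_
    rw [Complex.real_smul, mul_left_comm (starRingEnd ℂ _), Complex.re_ofReal_mul]
    ring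
  have hanti : AntitoneOn (fun t => energy N (x t)) (Icc 0 T) := by
    refine antitoneOn_of_deriv_nonpos (convex_Icc 0 T)
      (fun t ht => (hE t ht).continuousAt.continuousWithinAt)
      (fun t ht => (hE t (interior_subset ht)).differentiableAt.differentiableWithinAt)
      fun t ht => ?_
    rw [(hE t (interior_subset ht)).deriv]
    have h1 : 0 ≤ θ t := smoothTransition.nonneg _
    have h2 : 0 ≤ ∑ k ∈ freqs N, 1 * (‖extend N (x t) k‖ ^ 2 / |(k : ℝ)|) :=
      Finset.sum_nonneg fun k _ => by positivity
    nlinarith [mul_nonneg h1 h2]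
  have hθ : ∀ t ∈ Icc 0 T, θ t = 1 := by
    intro t ht
    have := hanti (left_mem_Icc.mpr hT.le) ht ht.1
    simp only [h0] at this
    exact smoothTransition.one_of_one_le (by linarith)
  refine ⟨fun t => extend N (x t), fun t => isRealSeq_extend _, fun t k hk => extend_eq_zero _ hk,
    fun k hk => ?_, fun t ht k hk => ?_⟩
  · rw [h0]
    unfold extend
    by_cases h1 : k ∈ Finset.Icc (1 : ℤ) N
    · simp [h1, x₀]
    · by_cases h2 : -k ∈ Finset.Icc (1 : ℤ) N
      · simp [h1, h2, x₀, ha₀.neg]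
      · have hk0 : k = 0 := by simp only [Finset.mem_Icc] at hk h1 h2; omega
        subst hk0
        simp [ha₀.zero]
  · have := hd t ht k hk
    rwa [hθ t ht, one_smul] at this

end

section

/-! ## A priori estimates -/

/-- The constant of the embedding `Ḣ^{5/2} ⊂ W^{1,∞}`. -/
def embConst : ℝ := ∑' k : ℤ, (|(k : ℝ)| ^ 3)⁻¹

lemma summable_embConst : Summable fun k : ℤ => (|(k : ℝ)| ^ 3)⁻¹ :=
  Summable.of_nat_of_neg (by simp) (by simp)

lemma embConst_nonneg : 0 ≤ embConst := tsum_nonneg fun k => by positivity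

/-- Cauchy-Schwarz with `|k| = |k|^(-3/2) |k|^(5/2)`. The exponent 5 is that of the damping in the
`Ḣ³` energy. -/
lemma sq_sum_le_embConst (S : Finset ℤ) (a : ℤ → ℂ) :
    (∑ k ∈ S, |(k : ℝ)| * ‖a k‖) ^ 2 ≤ embConst * ∑ k ∈ S, |(k : ℝ)| ^ 5 * ‖a k‖ ^ 2 := by
  refine (Finset.sum_sq_le_sum_mul_sum_of_sq_le_mul S (f := fun k : ℤ => (|(k : ℝ)| ^ 3)⁻¹)
    (g := fun k : ℤ => |(k : ℝ)| ^ 5 * ‖a k‖ ^ 2) (fun _ _ => by positivity)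
    (fun _ _ => by positivity) fun k _ => le_of_eq ?_).trans ?_
  · rcases eq_or_ne k 0 with rfl | hk
    · simp
    · have : |(k : ℝ)| ≠ 0 := by simpa using hk
      field_simp
  · have h : ∑ k ∈ S, (|(k : ℝ)| ^ 3)⁻¹ ≤ embConst :=
      summable_embConst.sum_le_tsum S fun _ _ => by positivity
    exact mul_le_mul_of_nonneg_right h (Finset.sum_nonneg fun _ _ => by positivity)

lemma pow_six_mul_div_abs (k : ℤ) (z : ℝ) : |(k : ℝ)| ^ 6 * (z / |(k : ℝ)|) = |(k : ℝ)| ^ 5 * z := by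
  rcases eq_or_ne k 0 with rfl | hk
  · simp
  · have : |(k : ℝ)| ≠ 0 := by simpa using hk
    field_simp

lemma mul_abs_pow_six (k : ℤ) : (k : ℝ) * |(k : ℝ)| ^ 6 = (k : ℝ) ^ 7 := by
  rw [Even.pow_abs (by decide)]
  ring

/-- If `2x ≤ s`, then already `1/x ≥ 2/s`; otherwise the left side is nonpositive, since `128 = 2 *
2⁶`. This is the interpolation between `Ḣ^{-1/2}` and `Ḣ³` behind the decay. -/
lemma div_abs_lower_bound {x s : ℝ} (hx : 0 < x) (hs : 0 < s) :
    2 / s - 128 * x ^ 6 / s ^ 7 ≤ 1 / x := by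
  have h : 2 * s ^ 6 * x ≤ s ^ 7 + 128 * x ^ 7 := by
    rcases le_total (2 * x) s with h | h
    · have : 2 * x * s ^ 6 ≤ s * s ^ 6 := by gcongr
      have : 0 < x ^ 7 := by positivity
      nlinarith
    · have : s ^ 6 * x ≤ (2 * x) ^ 6 * x := by gcongr
      have : 0 < s ^ 7 := by positivity
      nlinarith
  rw [sub_le_iff_le_add, div_add_div _ _ hx.ne' (by positivity),
    div_le_div_iff₀ hs (by positivity)]
  calc 2 * (x * s ^ 7) = 2 * s ^ 6 * x * s := by ring
    _ ≤ (s ^ 7 + 128 * x ^ 7) * s := by gcongr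
    _ = _ := by ring

/-- The derivative costs one power, from `wt 3` to `wt 2`, which is still summable. -/
lemma norm_rhs_le {a : ℤ → ℂ} {B : ℝ} (h : ∀ k, ‖a k‖ ≤ B * wt 3 k) (k : ℤ) :
    ‖rhs a k‖ ≤ (27 * B ^ 3 * wtSum 3 ^ 2 + B) * wt 2 k := by
  have hB : 0 ≤ B := nonneg_of_mul_nonneg_left ((norm_nonneg _).trans (h 0)) (wt_pos 3 0)
  have h1 := norm_conv3_le_of_decay h k
  have h2 : ‖a k / (|(k : ℝ)| : ℝ)‖ ≤ B * wt 2 k := by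
    rw [norm_div, Complex.norm_real, norm_eq_abs, abs_abs]
    rcases eq_or_ne k 0 with rfl | hk
    · simpa using mul_nonneg hB (wt_pos 2 0).le
    · have : (1 : ℝ) ≤ |(k : ℝ)| := by exact_mod_cast Int.one_le_abs hk
      exact (div_le_self (norm_nonneg _) this).trans ((h k).trans
        (mul_le_mul_of_nonneg_left (wt_anti (by norm_num) k) hB))
  have h3 : ‖-(Complex.I * k / 3) * conv3 a k‖ ≤ 27 * B ^ 3 * wtSum 3 ^ 2 * wt 2 k := by
    rw [norm_mul]
    calc _ = |(k : ℝ)| / 3 * ‖conv3 a k‖ := by simp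
      _ ≤ |(k : ℝ)| / 3 * (81 * B ^ 3 * wtSum 3 ^ 2 * wt 3 k) := by gcongr
      _ = 27 * B ^ 3 * wtSum 3 ^ 2 * (|(k : ℝ)| * wt 3 k) := by ring
      _ ≤ _ := mul_le_mul_of_nonneg_left (abs_mul_wt_succ_le 2 k) (by positivity)
  calc _ ≤ _ := norm_sub_le _ _
    _ ≤ _ := add_le_add h3 h2
    _ = _ := by ring

lemma norm_rhs_sub_le {a b : ℤ → ℂ} {B δ : ℝ} (ha : ∀ k, ‖a k‖ ≤ B * wt 2 k)
    (hb : ∀ k, ‖b k‖ ≤ B * wt 2 k) (hab : ∀ k, ‖a k - b k‖ ≤ δ * wt 2 k) (k : ℤ) :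
    ‖rhs a k - rhs b k‖ ≤ (|(k : ℝ)| * B ^ 2 * wtSum 2 ^ 2 + 1) * δ := by
  have hδ : 0 ≤ δ := nonneg_of_mul_nonneg_left ((norm_nonneg _).trans (hab 0)) (wt_pos 2 0)
  have h1 := norm_conv3_sub_le ha hb hab k
  have h2 : ‖(a k - b k) / (|(k : ℝ)| : ℝ)‖ ≤ δ := by
    rw [norm_div, Complex.norm_real, norm_eq_abs, abs_abs]
    rcases eq_or_ne k 0 with rfl | hk
    · simpa using hδ
    · have : (1 : ℝ) ≤ |(k : ℝ)| := by exact_mod_cast Int.one_le_abs hk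
      exact (div_le_self (norm_nonneg _) this).trans ((hab k).trans
        (mul_le_of_le_one_right hδ (wt_le_one 2 k)))
  have h3 : ‖-(Complex.I * k / 3) * (conv3 a k - conv3 b k)‖ ≤
      |(k : ℝ)| * B ^ 2 * wtSum 2 ^ 2 * δ := by
    rw [norm_mul]
    calc _ = |(k : ℝ)| / 3 * ‖conv3 a k - conv3 b k‖ := by simp
      _ ≤ |(k : ℝ)| / 3 * (3 * δ * B ^ 2 * wtSum 2 ^ 2) := by gcongr
      _ = _ := by ring
  rw [show rhs a k - rhs b k = -(Complex.I * k / 3) * (conv3 a k - conv3 b k) -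
    (a k - b k) / (|(k : ℝ)| : ℝ) by simp only [rhs]; ring]
  calc _ ≤ _ := norm_sub_le _ _
    _ ≤ _ := add_le_add h3 h2
    _ = _ := by ring

/-- A bound on the `Ḣ³` norm gives decay of the coefficients. -/
lemma norm_le_of_sum_le {a : ℤ → ℂ} (ha : IsRealSeq a) {M : ℝ} (hM : 0 ≤ M)
    (h : ∀ S : Finset ℤ, ∑ k ∈ S, |(k : ℝ)| ^ 6 * ‖a k‖ ^ 2 ≤ M ^ 2) (k : ℤ) :
    ‖a k‖ ≤ 8 * M * wt 3 k := by
  rcases eq_or_ne k 0 with rfl | hk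
  · rw [ha.zero, norm_zero]
    exact mul_nonneg (by positivity) (wt_pos 3 0).le
  · have h1 : (1 : ℝ) ≤ |(k : ℝ)| := by exact_mod_cast Int.one_le_abs hk
    have h2 : |(k : ℝ)| ^ 3 * ‖a k‖ ≤ M := by
      refine le_of_pow_le_pow_left₀ two_ne_zero hM ?_
      have := h {k}
      rw [Finset.sum_singleton] at this
      rwa [mul_pow, ← pow_mul]
    rw [wt, ← div_eq_mul_inv, le_div_iff₀ (by positivity)]
    calc ‖a k‖ * (1 + |(k : ℝ)|) ^ 3 ≤ ‖a k‖ * (2 * |(k : ℝ)|) ^ 3 := by gcongr; linarith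
      _ = 8 * (|(k : ℝ)| ^ 3 * ‖a k‖) := by ring
      _ ≤ _ := by gcongr

variable {N : ℕ} {T : ℝ} {a₀ : ℤ → ℂ} {a : ℝ → ℤ → ℂ}

lemma sum_le_sum_freqs {a : ℤ → ℂ} (ha : ∀ k ∉ freqs N, a k = 0) (g : ℤ → ℝ) (hg : ∀ k, 0 ≤ g k)
    (S : Finset ℤ) : ∑ k ∈ S, g k * ‖a k‖ ^ 2 ≤ ∑ k ∈ freqs N, g k * ‖a k‖ ^ 2 := by
  have hs : ∀ k ∉ freqs N, g k * ‖a k‖ ^ 2 = 0 := fun k hk => by simp [ha k hk]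
  have h : HasSum (fun k => g k * ‖a k‖ ^ 2) (∑ k ∈ freqs N, g k * ‖a k‖ ^ 2) :=
    hasSum_sum_of_ne_finset_zero hs
  exact sum_le_hasSum S (fun k _ => mul_nonneg (hg k) (sq_nonneg _)) h

/-- The nonlinear term is absorbed by the damping as soon as the `Ḣ³` energy is small; `448 = 2/3 *
672`. -/
lemma deriv_sobolev_le {a : ℤ → ℂ} (ha : IsRealSeq a) (hs : ∀ k ∉ freqs N, a k = 0) :
    ∑ k ∈ freqs N, |(k : ℝ)| ^ 6 * (2 * (starRingEnd ℂ (a k) * rhs a k).re) ≤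
      (448 * embConst * (∑ k ∈ freqs N, |(k : ℝ)| ^ 6 * ‖a k‖ ^ 2) - 2) *
        ∑ k ∈ freqs N, |(k : ℝ)| ^ 5 * ‖a k‖ ^ 2 := by
  rw [sum_energy]
  simp only [mul_abs_pow_six, pow_six_mul_div_abs]
  have hsum : ∀ f : ℤ → ℂ → ℝ, (∀ k, f k 0 = 0) →
      HasSum (fun k => f k (a k)) (∑ k ∈ freqs N, f k (a k)) := fun f hf =>
    hasSum_sum_of_ne_finset_zero fun k hk => by rw [hs k hk, hf]
  have h1 := isTame_pow.norm_energy_le ha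
    (hsum (fun k z => |(k : ℝ) ^ 7| * ‖z‖) (by simp)).summable
    (hsum (fun k z => |(k : ℝ)| ^ 6 * ‖z‖ ^ 2) (by simp))
    (hsum (fun k z => |(k : ℝ)| * ‖z‖) (by simp))
  rw [tsum_eq_sum (s := freqs N) (fun k hk => by simp [hs k hk])] at h1
  have h2 := (le_abs_self _).trans ((Complex.abs_im_le_norm _).trans h1)
  have h3 := sq_sum_le_embConst (freqs N) a
  have h4 : 0 ≤ ∑ k ∈ freqs N, |(k : ℝ)| ^ 6 * ‖a k‖ ^ 2 :=
    Finset.sum_nonneg fun _ _ => by positivity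
  have h5 := mul_le_mul_of_nonneg_left h3 h4
  linarith

namespace IsGalerkin

lemma hasDerivAt_energy (h : IsGalerkin N T a₀ a) (g : ℤ → ℝ) {t : ℝ} (ht : t ∈ Icc 0 T) :
    HasDerivAt (fun t => ∑ k ∈ freqs N, g k * ‖a t k‖ ^ 2)
      (∑ k ∈ freqs N, g k * (2 * (starRingEnd ℂ (a t k) * rhs (a t) k).re)) t := by
  have := hasDerivAt_weighted_energy (g := g) (s := univ)
    (fun k hk => (h.deriv t ht k hk).hasDerivWithinAt)
  rwa [hasDerivWithinAt_univ] at this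

lemma sobolev_le (h : IsGalerkin N T a₀ a) {M : ℝ} (hM : 448 * embConst * M ^ 2 ≤ 1)
    (h0 : ∀ S : Finset ℤ, ∑ k ∈ S, |(k : ℝ)| ^ 6 * ‖a₀ k‖ ^ 2 ≤ M ^ 2) {t : ℝ} (ht : t ∈ Icc 0 T)
    (S : Finset ℤ) : ∑ k ∈ S, |(k : ℝ)| ^ 6 * ‖a t k‖ ^ 2 ≤ M ^ 2 := by
  refine (sum_le_sum_freqs (h.supp t) (fun k => |(k : ℝ)| ^ 6) (fun _ => by positivity) S).trans ?_
  have hT : 0 ≤ T := ht.1.trans ht.2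
  -- The barrier `M² + η t` is strictly increasing. At a contact point the factor `448 * embConst *
  -- (M² + η r) - 2` is nonpositive, so the energy cannot cross; then `η → 0`.
  have key : ∀ η > 0, 448 * embConst * (η * T) ≤ 1 →
      ∑ k ∈ freqs N, |(k : ℝ)| ^ 6 * ‖a t k‖ ^ 2 ≤ M ^ 2 + η * t := by
    intro η hη hηT
    refine image_le_of_deriv_right_lt_deriv_boundary (B := fun t => M ^ 2 + η * t)
      (B' := fun _ => η) (fun t ht => (h.hasDerivAt_energy _ ht).continuousAt.continuousWithinAt)
      (fun t ht => (h.hasDerivAt_energy _ (Ico_subset_Icc_self ht)).hasDerivWithinAt) ?_ ?_ ?_ ht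
    · rw [mul_zero, add_zero]
      refine (Finset.sum_le_sum fun k hk => ?_).trans (h0 (freqs N))
      rw [h.init k hk]
    · intro t
      simpa using ((hasDerivAt_id t).const_mul η).const_add (M ^ 2)
    · intro r hr hEq
      refine (deriv_sobolev_le (h.real r) (h.supp r)).trans_lt ?_
      rw [hEq]
      refine lt_of_le_of_lt (mul_nonpos_of_nonpos_of_nonneg ?_
        (Finset.sum_nonneg fun _ _ => by positivity)) hη
      have : 448 * embConst * (η * r) ≤ 448 * embConst * (η * T) := by
        have := embConst_nonneg
        have := hr.2.le
        gcongr
      linarith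
  have hlim : Tendsto (fun η : ℝ => M ^ 2 + η * t) (𝓝[>] 0) (𝓝 (M ^ 2)) := by
    have : Continuous fun η : ℝ => M ^ 2 + η * t := by fun_prop
    simpa using (this.tendsto 0).mono_left nhdsWithin_le_nhds
  have hsmall : ∀ᶠ η : ℝ in 𝓝[>] 0, 448 * embConst * (η * T) ≤ 1 := by
    have : Continuous fun η : ℝ => 448 * embConst * (η * T) := by fun_prop
    have := (this.tendsto 0).mono_left (nhdsWithin_le_nhds (s := Ioi 0))
    simp only [zero_mul, mul_zero] at this
    exact (this.eventually_lt_const zero_lt_one).mono fun _ h => h.le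
  refine ge_of_tendsto hlim ?_
  filter_upwards [hsmall, self_mem_nhdsWithin] with η h1 h2 using key η h2 h1

lemma deriv_energy_le {a : ℤ → ℂ} (ha : IsRealSeq a) {M : ℝ}
    (h : ∑ k ∈ freqs N, |(k : ℝ)| ^ 6 * ‖a k‖ ^ 2 ≤ M ^ 2) {s : ℝ} (hs : 0 < s) :
    -2 * ∑ k ∈ freqs N, 1 * (‖a k‖ ^ 2 / |(k : ℝ)|) ≤
      -(4 / s) * (∑ k ∈ freqs N, 1 * ‖a k‖ ^ 2) + 256 * M ^ 2 / s ^ 7 := by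
  have h1 : ∀ k, 2 / s * (1 * ‖a k‖ ^ 2) - 128 / s ^ 7 * (|(k : ℝ)| ^ 6 * ‖a k‖ ^ 2) ≤
      1 * (‖a k‖ ^ 2 / |(k : ℝ)|) := by
    intro k
    rcases eq_or_ne k 0 with rfl | hk
    · simp [ha.zero]
    · have := mul_le_mul_of_nonneg_right (div_abs_lower_bound (x := |(k : ℝ)|) (by positivity) hs)
        (sq_nonneg ‖a k‖)
      calc _ = _ := by ring
        _ ≤ _ := this
        _ = _ := by ring
  have h2 := Finset.sum_le_sum fun k (_ : k ∈ freqs N) => h1 k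
  rw [Finset.sum_sub_distrib, ← Finset.mul_sum,
    ← Finset.mul_sum (f := fun k : ℤ => |(k : ℝ)| ^ 6 * ‖a k‖ ^ 2)] at h2
  have h3 : 128 / s ^ 7 * ∑ k ∈ freqs N, |(k : ℝ)| ^ 6 * ‖a k‖ ^ 2 ≤ 128 / s ^ 7 * M ^ 2 := by
    gcongr
  calc _ ≤ -2 * (2 / s * (∑ k ∈ freqs N, 1 * ‖a k‖ ^ 2) - 128 / s ^ 7 * M ^ 2) := by linarith
    _ = _ := by ring

lemma energy_decay (h : IsGalerkin N T a₀ a) {M : ℝ} (hM : 448 * embConst * M ^ 2 ≤ 1)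
    (h0 : ∀ S : Finset ℤ, ∑ k ∈ S, |(k : ℝ)| ^ 6 * ‖a₀ k‖ ^ 2 ≤ M ^ 2) {t : ℝ} (ht : t ∈ Icc 0 T)
    (S : Finset ℤ) : ∑ k ∈ S, ‖a t k‖ ^ 2 ≤ 129 * M ^ 2 / (1 + t) ^ 4 := by
  have hle := sum_le_sum_freqs (h.supp t) (fun _ => 1) (fun _ => zero_le_one) S
  simp only [one_mul] at hle
  refine hle.trans ?_
  have hT : 0 ≤ T := ht.1.trans ht.2
  set E : ℝ → ℝ := fun t => ∑ k ∈ freqs N, 1 * ‖a t k‖ ^ 2 with hE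
  -- With `s = 1 + t` in `deriv_energy_le`, `E' ≤ -4E/(1+t) + 256 M²/(1+t)⁷`. The integrating factor
  -- is `(1+t)⁴`, and the second term of `Q` offsets the source. At time 0, `Q ≤ (1 + 128) M²`.
  set Q : ℝ → ℝ := fun t => (1 + t) ^ 4 * E t + 128 * M ^ 2 / (1 + t) ^ 2 with hQ
  have hQd : ∀ t ∈ Icc 0 T, ∃ q ≤ 0, HasDerivAt Q q t := by
    intro t ht
    have hs : 0 < 1 + t := by linarith [ht.1]
    have e1 := h.hasDerivAt_energy (fun _ => 1) ht
    rw [energy_rhs (h.real t) (h.supp t)] at e1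
    have e2 : HasDerivAt (fun t : ℝ => 1 + t) 1 t := (hasDerivAt_id t).const_add 1
    have e3 := ((e2.pow 4).mul e1).add
      ((hasDerivAt_const t (128 * M ^ 2)).div (e2.pow 2) (pow_ne_zero 2 hs.ne'))
    refine ⟨_, ?_, e3⟩
    have e4 := mul_le_mul_of_nonneg_left (deriv_energy_le (h.real t) (h.sobolev_le hM h0 ht (freqs N)) hs)
      (show 0 ≤ (1 + t) ^ 4 by positivity)
    have e5 : (1 + t) ^ 4 * (-(4 / (1 + t)) * E t + 256 * M ^ 2 / (1 + t) ^ 7) =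
      -(4 * (1 + t) ^ 3 * E t) + 256 * M ^ 2 / (1 + t) ^ 3 := by field_simp
    rw [e5] at e4
    have e6 : (0 * (1 + t) ^ 2 - 128 * M ^ 2 * (2 * (1 + t) ^ (2 - 1) * 1)) / ((1 + t) ^ 2) ^ 2 =
      -(256 * M ^ 2 / (1 + t) ^ 3) := by field_simp; ring
    simp only [Pi.pow_apply, Nat.cast_ofNat, Nat.reduceSub, mul_one] at e6 ⊢
    rw [e6]
    linarith
  have hanti : AntitoneOn Q (Icc 0 T) := by
    refine antitoneOn_of_deriv_nonpos (convex_Icc 0 T)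
      (fun t ht => (hQd t ht).choose_spec.2.continuousAt.continuousWithinAt)
      (fun t ht => (hQd t (interior_subset ht)).choose_spec.2.differentiableAt.differentiableWithinAt)
      fun t ht => ?_
    obtain ⟨q, hq, hd⟩ := hQd t (interior_subset ht)
    rwa [hd.deriv]
  have h1 := hanti (left_mem_Icc.mpr hT) ht ht.1
  have h2 : E 0 ≤ M ^ 2 := by
    refine (Finset.sum_le_sum fun k hk => ?_).trans (h.sobolev_le hM h0 (left_mem_Icc.mpr hT) (freqs N))
    rcases eq_or_ne k 0 with rfl | hk
    · simp [(h.real 0).zero]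
    · have : (1 : ℝ) ≤ |(k : ℝ)| := by exact_mod_cast Int.one_le_abs hk
      gcongr
      exact one_le_pow₀ this
  have hs : 0 < 1 + t := by linarith [ht.1]
  have h3 : 0 ≤ 128 * M ^ 2 / (1 + t) ^ 2 := by positivity
  rw [le_div_iff₀ (by positivity)]
  simp only [hQ] at h1
  norm_num at h1
  have h4 : E t = ∑ k ∈ freqs N, ‖a t k‖ ^ 2 := by simp [hE]
  rw [← h4]
  linarith

end IsGalerkin

end

section

/-! ## Passage to the limit -/

/-- The rate in the Lipschitz bound of the coefficients in time. -/
def lipRate (M : ℝ) : ℝ := 27 * (8 * M) ^ 3 * wtSum 3 ^ 2 + 8 * M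

lemma lipRate_nonneg {M : ℝ} (hM : 0 ≤ M) : 0 ≤ lipRate M := by
  unfold lipRate
  positivity

/-- A first-order expansion with quadratic remainder survives pointwise limits, so differentiability
passes to the limit without any convergence of derivatives. -/
lemma hasDerivWithinAt_of_quadratic {f : ℝ → ℂ} {f' : ℂ} {s : Set ℝ} {t C : ℝ}
    (h : ∀ r ∈ s, ‖f r - f t - (r - t) • f'‖ ≤ C * |r - t| ^ 2) : HasDerivWithinAt f f' s t := by
  rw [hasDerivWithinAt_iff_isLittleO]
  have h1 : (fun r => f r - f t - (r - t) • f') =O[𝓝[s] t] fun r => ‖r - t‖ ^ 2 :=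
    Asymptotics.IsBigO.of_bound C (by
      filter_upwards [self_mem_nhdsWithin] with r hr
      simpa using h r hr)
  exact h1.trans_isLittleO
    ((Asymptotics.isLittleO_pow_sub_sub t one_lt_two).mono nhdsWithin_le_nhds)

/-- A solution of the equation on the Fourier side, for all positive times. -/
structure IsSpectral (M : ℝ) (a₀ : ℤ → ℂ) (a : ℝ → ℤ → ℂ) : Prop where
  real : ∀ t, 0 ≤ t → IsRealSeq (a t)
  init : a 0 = a₀
  sobolev : ∀ t, 0 ≤ t → ∀ S : Finset ℤ, ∑ k ∈ S, |(k : ℝ)| ^ 6 * ‖a t k‖ ^ 2 ≤ M ^ 2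
  decay : ∀ t, 0 ≤ t → ∀ S : Finset ℤ, ∑ k ∈ S, ‖a t k‖ ^ 2 ≤ 129 * M ^ 2 / (1 + t) ^ 4
  deriv : ∀ t, 0 ≤ t → ∀ k, HasDerivWithinAt (fun t => a t k) (rhs (a t) k) (Ici 0) t

section Galerkin

variable {N : ℕ} {T M : ℝ} {a₀ : ℤ → ℂ} {a : ℝ → ℤ → ℂ}

namespace IsGalerkin

lemma norm_le (h : IsGalerkin N T a₀ a) (hM0 : 0 ≤ M) (hM : 448 * embConst * M ^ 2 ≤ 1)
    (h0 : ∀ S : Finset ℤ, ∑ k ∈ S, |(k : ℝ)| ^ 6 * ‖a₀ k‖ ^ 2 ≤ M ^ 2) {t : ℝ} (ht : t ∈ Icc 0 T)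
    (k : ℤ) : ‖a t k‖ ≤ 8 * M * wt 3 k :=
  norm_le_of_sum_le (h.real t) hM0 (h.sobolev_le hM h0 ht) k

lemma lipschitz (h : IsGalerkin N T a₀ a) (hM0 : 0 ≤ M) (hM : 448 * embConst * M ^ 2 ≤ 1)
    (h0 : ∀ S : Finset ℤ, ∑ k ∈ S, |(k : ℝ)| ^ 6 * ‖a₀ k‖ ^ 2 ≤ M ^ 2) {s t : ℝ}
    (hs : s ∈ Icc 0 T) (ht : t ∈ Icc 0 T) (k : ℤ) :
    ‖a t k - a s k‖ ≤ lipRate M * wt 2 k * |t - s| := by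
  by_cases hk : k ∈ freqs N
  · exact (convex_Icc 0 T).norm_image_sub_le_of_norm_hasDerivWithin_le
      (fun r hr => (h.deriv r hr k hk).hasDerivWithinAt)
      (fun r hr => norm_rhs_le (h.norm_le hM0 hM h0 hr) k) hs ht
  · rw [h.supp t k hk, h.supp s k hk, sub_zero, norm_zero]
    have := lipRate_nonneg hM0
    have := wt_pos 2 k
    positivity

/-- At a fixed frequency `rhs` is Lipschitz along the trajectory, so the mean value inequality
applied after removing the linear part gives a remainder uniform in `N`. -/
lemma quadratic (h : IsGalerkin N T a₀ a) (hM0 : 0 ≤ M) (hM : 448 * embConst * M ^ 2 ≤ 1)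
    (h0 : ∀ S : Finset ℤ, ∑ k ∈ S, |(k : ℝ)| ^ 6 * ‖a₀ k‖ ^ 2 ≤ M ^ 2) {s t : ℝ}
    (hs : s ∈ Icc 0 T) (ht : t ∈ Icc 0 T) {k : ℤ} (hk : k ∈ freqs N) :
    ‖a t k - a s k - (t - s) • rhs (a s) k‖ ≤
      (|(k : ℝ)| * (8 * M) ^ 2 * wtSum 2 ^ 2 + 1) * lipRate M * |t - s| ^ 2 := by
  have hsub : uIcc s t ⊆ Icc 0 T := uIcc_subset_Icc hs ht
  have hB : ∀ r ∈ Icc 0 T, ∀ k, ‖a r k‖ ≤ 8 * M * wt 2 k := fun r hr k =>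
    (h.norm_le hM0 hM h0 hr k).trans
      (mul_le_mul_of_nonneg_left (wt_anti (by norm_num) k) (by positivity))
  have hd : ∀ r ∈ uIcc s t, HasDerivWithinAt (fun r => a r k - (r - s) • rhs (a s) k)
      (rhs (a r) k - rhs (a s) k) (uIcc s t) r := by
    intro r hr
    have := ((hasDerivAt_id r).sub_const s).smul_const (rhs (a s) k)
    rw [one_smul] at this
    exact ((h.deriv r (hsub hr) k hk).sub this).hasDerivWithinAt
  have hb : ∀ r ∈ uIcc s t, ‖rhs (a r) k - rhs (a s) k‖ ≤
      (|(k : ℝ)| * (8 * M) ^ 2 * wtSum 2 ^ 2 + 1) * (lipRate M * |t - s|) := by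
    intro r hr
    refine norm_rhs_sub_le (hB r (hsub hr)) (hB s hs) (fun j => ?_) k
    refine (h.lipschitz hM0 hM h0 hs (hsub hr) j).trans ?_
    rw [mul_right_comm]
    have h1 : |r - s| ≤ |t - s| := abs_sub_left_of_mem_uIcc hr
    have := lipRate_nonneg hM0
    have := (wt_pos 2 j).le
    gcongr
  have := (convex_uIcc s t).norm_image_sub_le_of_norm_hasDerivWithin_le hd hb
    left_mem_uIcc right_mem_uIcc
  simp only [sub_self, zero_smul, sub_zero] at this
  calc ‖a t k - a s k - (t - s) • rhs (a s) k‖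
      = ‖a t k - (t - s) • rhs (a s) k - a s k‖ := by rw [sub_right_comm]
    _ ≤ _ := this
    _ = _ := by rw [norm_eq_abs]; ring

end IsGalerkin

lemma exists_isSpectral (hM0 : 0 ≤ M) (hM : 448 * embConst * M ^ 2 ≤ 1) (ha₀ : IsRealSeq a₀)
    (h0 : ∀ S : Finset ℤ, ∑ k ∈ S, |(k : ℝ)| ^ 6 * ‖a₀ k‖ ^ 2 ≤ M ^ 2) :
    ∃ a, IsSpectral M a₀ a := by
  -- The horizon `N + 1` grows, so every nonnegative time is eventually covered.
  choose a ha using fun N : ℕ => exists_isGalerkin (T := N + 1) (by positivity) ha₀ N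
  -- An ultrafilter gives convergence for all times and frequencies at once, with no diagonal
  -- extraction; the bounds are closed conditions.
  set l : Filter ℕ := (hyperfilter ℕ : Filter ℕ) with hl
  have hle : l ≤ atTop := Nat.hyperfilter_le_atTop
  have htime : ∀ t : ℝ, 0 ≤ t → ∀ᶠ N : ℕ in l, t ∈ Icc (0 : ℝ) (N + 1) := by
    intro t ht
    refine hle ?_
    filter_upwards [eventually_ge_atTop ⌈t⌉₊] with N hN
    exact ⟨ht, by linarith [Nat.ceil_le.mp hN]⟩
  have hfreq : ∀ k : ℤ, ∀ᶠ N : ℕ in l, k ∈ freqs N := by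
    intro k
    refine hle ?_
    filter_upwards [eventually_ge_atTop k.natAbs] with N hN
    rw [Finset.mem_Icc]
    omega
  have hlim : ∀ t k, ∃ z, 0 ≤ t → Tendsto (fun N => a N t k) l (𝓝 z) := by
    intro t k
    by_cases ht : 0 ≤ t
    · have hmem : ∀ᶠ N in l, a N t k ∈ Metric.closedBall 0 (8 * M * wt 3 k) :=
        (htime t ht).mono fun N hN => by
          rw [mem_closedBall_zero_iff]
          exact (ha N).norm_le hM0 hM h0 hN k
      obtain ⟨z, -, hz⟩ := (isCompact_closedBall (0 : ℂ) (8 * M * wt 3 k)).ultrafilter_le_nhds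
        ((hyperfilter ℕ).map fun N => a N t k) (le_principal_iff.mpr hmem)
      exact ⟨z, fun _ => hz⟩
    · exact ⟨0, fun h => absurd h ht⟩
  choose b hb using hlim
  have hrhs : ∀ t, 0 ≤ t → ∀ k, Tendsto (fun N => rhs (a N t) k) l (𝓝 (rhs (b t) k)) := by
    intro t ht k
    refine ((tendsto_conv3 (M := 8 * M) ?_ (fun k => hb t k ht) k).const_mul _).sub
      ((hb t k ht).div_const _)
    filter_upwards [htime t ht] with N hN j
    exact ((ha N).norm_le hM0 hM h0 hN j).trans
      (mul_le_mul_of_nonneg_left (wt_anti (by norm_num) j) (by positivity))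
  refine ⟨b, fun t ht => ⟨?_, fun k => ?_⟩, ?_, fun t ht S => ?_, fun t ht S => ?_, fun t ht k => ?_⟩
  · refine tendsto_nhds_unique (hb t 0 ht) ?_
    simp only [((ha _).real t).zero]
    exact tendsto_const_nhds
  · refine tendsto_nhds_unique (hb t (-k) ht) ?_
    simp only [((ha _).real t).neg]
    exact (Complex.continuous_conj.tendsto _).comp (hb t k ht)
  · funext k
    refine tendsto_nhds_unique (hb 0 k le_rfl) ?_
    exact tendsto_const_nhds.congr' ((hfreq k).mono fun N hN => ((ha N).init k hN).symm)
  · refine le_of_tendsto (tendsto_finsetSum S fun k _ => ((hb t k ht).norm.pow 2).const_mul _)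
      ((htime t ht).mono fun N hN => (ha N).sobolev_le hM h0 hN S)
  · refine le_of_tendsto (tendsto_finsetSum S fun k _ => (hb t k ht).norm.pow 2)
      ((htime t ht).mono fun N hN => (ha N).energy_decay hM h0 hN S)
  · refine hasDerivWithinAt_of_quadratic (C := (|(k : ℝ)| * (8 * M) ^ 2 * wtSum 2 ^ 2 + 1) *
      lipRate M) fun r hr => ?_
    refine le_of_tendsto (((hb r k hr).sub (hb t k ht)).sub ((hrhs t ht k).const_smul _)).norm ?_
    filter_upwards [htime t ht, htime r hr, hfreq k] with N h1 h2 h3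
    exact (ha N).quadratic hM0 hM h0 h1 h2 h3

end Galerkin

end

section

/-! ## Strong continuity in time -/

/-- Pointwise convergence and convergence of weighted norms imply strong convergence. -/
lemma tendsto_tsum_norm_sub_sq {ι : Type*} {l : Filter ι} {x : ι → ℤ → ℂ} {y : ℤ → ℂ} {g : ℤ → ℝ}
    (hg : ∀ k, 0 ≤ g k) (hx : ∀ᶠ i in l, Summable fun k => g k * ‖x i k‖ ^ 2)
    (hy : Summable fun k => g k * ‖y k‖ ^ 2) (hxy : ∀ k, Tendsto (fun i => x i k) l (𝓝 (y k)))
    (hn : Tendsto (fun i => ∑' k, g k * ‖x i k‖ ^ 2) l (𝓝 (∑' k, g k * ‖y k‖ ^ 2))) :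
    Tendsto (fun i => ∑' k, g k * ‖x i k - y k‖ ^ 2) l (𝓝 0) := by
  have hd : ∀ i k, g k * ‖x i k - y k‖ ^ 2 ≤
      2 * (g k * ‖x i k‖ ^ 2) + 2 * (g k * ‖y k‖ ^ 2) := by
    intro i k
    have h1 := norm_sub_le (x i k) (y k)
    have h2 : ‖x i k - y k‖ ^ 2 ≤ 2 * ‖x i k‖ ^ 2 + 2 * ‖y k‖ ^ 2 := by
      nlinarith [norm_nonneg (x i k - y k), sq_nonneg (‖x i k‖ - ‖y k‖)]
    nlinarith [mul_le_mul_of_nonneg_left h2 (hg k)]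
  -- Termwise, `|x-y|² ≤ min(|x-y|², 4|y|²) + 2(|x|² - |y|²) + 2 max(|y|² - |x|², 0)`. The first and
  -- last terms are dominated by multiples of `|y|²`, independent of `i`; the middle one is the
  -- convergence of norms.
  have h1 : Tendsto (fun i => ∑' k, min (g k * ‖x i k - y k‖ ^ 2) (4 * (g k * ‖y k‖ ^ 2))) l
      (𝓝 0) := by
    suffices H : Tendsto _ l (𝓝 (∑' _ : ℤ, (0 : ℝ))) by rwa [tsum_zero] at H
    refine tendsto_tsum_of_dominated_convergence (hy.mul_left 4) (fun k => ?_)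
      (Eventually.of_forall fun i k => ?_)
    · have := ((((hxy k).sub_const (y k)).norm.pow 2).const_mul (g k)).min
        (tendsto_const_nhds (x := 4 * (g k * ‖y k‖ ^ 2)))
      have h0 := hg k
      rwa [sub_self, norm_zero, zero_pow two_ne_zero, mul_zero, min_eq_left (by positivity)] at this
    · have h0 := hg k
      rw [norm_eq_abs, abs_of_nonneg (by positivity)]
      exact min_le_right _ _
  have h2 : Tendsto (fun i => ∑' k, max (g k * ‖y k‖ ^ 2 - g k * ‖x i k‖ ^ 2) 0) l (𝓝 0) := by
    suffices H : Tendsto _ l (𝓝 (∑' _ : ℤ, (0 : ℝ))) by rwa [tsum_zero] at H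
    refine tendsto_tsum_of_dominated_convergence hy (fun k => ?_)
      (Eventually.of_forall fun i k => ?_)
    · have := ((((hxy k).norm.pow 2).const_mul (g k)).const_sub (g k * ‖y k‖ ^ 2)).max
        (tendsto_const_nhds (x := (0 : ℝ)))
      rwa [sub_self, max_self] at this
    · have h0 := hg k
      rw [norm_eq_abs, abs_of_nonneg (le_max_right _ _)]
      exact max_le (sub_le_self _ (by positivity)) (by positivity)
  have h3 := (h1.add ((hn.sub_const (∑' k, g k * ‖y k‖ ^ 2)).const_mul 2)).add (h2.const_mul 2)
  rw [sub_self, mul_zero, add_zero, add_zero] at h3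
  refine tendsto_of_tendsto_of_tendsto_of_le_of_le' tendsto_const_nhds h3
    (Eventually.of_forall fun i => tsum_nonneg fun k => mul_nonneg (hg k) (sq_nonneg _))
    (hx.mono fun i hi => ?_)
  have s0 : Summable fun k => g k * ‖x i k - y k‖ ^ 2 :=
    Summable.of_nonneg_of_le (fun k => mul_nonneg (hg k) (sq_nonneg _)) (hd i)
      ((hi.mul_left 2).add (hy.mul_left 2))
  have s1 : Summable fun k => min (g k * ‖x i k - y k‖ ^ 2) (4 * (g k * ‖y k‖ ^ 2)) :=
    Summable.of_nonneg_of_le (fun k => le_min (mul_nonneg (hg k) (sq_nonneg _))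
      (mul_nonneg (by norm_num) (mul_nonneg (hg k) (sq_nonneg _)))) (fun k => min_le_left _ _) s0
  have s2 : Summable fun k => max (g k * ‖y k‖ ^ 2 - g k * ‖x i k‖ ^ 2) 0 :=
    Summable.of_nonneg_of_le (fun k => le_max_right _ _)
      (fun k => max_le (sub_le_self _ (mul_nonneg (hg k) (sq_nonneg _)))
        (mul_nonneg (hg k) (sq_nonneg _))) hy
  rw [← Summable.tsum_sub hi hy, ← tsum_mul_left, ← tsum_mul_left,
    ← s1.tsum_add ((hi.sub hy).mul_left 2),
    ← (s1.add ((hi.sub hy).mul_left 2)).tsum_add (s2.mul_left 2)]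
  refine s0.tsum_le_tsum (fun k => ?_) ((s1.add ((hi.sub hy).mul_left 2)).add (s2.mul_left 2))
  have h4 := hd i k
  have h5 := le_max_left (g k * ‖y k‖ ^ 2 - g k * ‖x i k‖ ^ 2) 0
  have h6 := le_max_right (g k * ‖y k‖ ^ 2 - g k * ‖x i k‖ ^ 2) 0
  rcases le_total (g k * ‖x i k - y k‖ ^ 2) (4 * (g k * ‖y k‖ ^ 2)) with h | h
  · rw [min_eq_left h]
    linarith
  · rw [min_eq_right h]
    linarith

lemma cutoff_eq_zero_of_notMem {n : ℕ} (hn : n ≠ 0) {k : ℤ} (hk : k ∉ freqs n) :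
    cutoff n k = 0 := by
  refine cutoff_eq_zero hn ?_
  rw [Finset.mem_Icc, ← abs_le, not_le] at hk
  exact_mod_cast hk.le

namespace IsSpectral

variable {M : ℝ} {a₀ : ℤ → ℂ} {a : ℝ → ℤ → ℂ}

lemma norm_le (h : IsSpectral M a₀ a) (hM : 0 ≤ M) {t : ℝ} (ht : 0 ≤ t) (k : ℤ) :
    ‖a t k‖ ≤ 8 * M * wt 3 k :=
  norm_le_of_sum_le (h.real t ht) hM (h.sobolev t ht) k

lemma lipschitz (h : IsSpectral M a₀ a) (hM : 0 ≤ M) {s t : ℝ} (hs : 0 ≤ s) (ht : 0 ≤ t) (k : ℤ) :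
    ‖a t k - a s k‖ ≤ lipRate M * wt 2 k * |t - s| :=
  (convex_Ici 0).norm_image_sub_le_of_norm_hasDerivWithin_le
    (fun _ hr => h.deriv _ hr k) (fun _ hr => norm_rhs_le (h.norm_le hM hr) k) hs ht

lemma tendsto_coeff (h : IsSpectral M a₀ a) {t : ℝ} (ht : 0 ≤ t) (k : ℤ) :
    Tendsto (fun r => a r k) (𝓝[Ici 0] t) (𝓝 (a t k)) :=
  (h.deriv t ht k).continuousWithinAt

lemma summable_sobolev (h : IsSpectral M a₀ a) {t : ℝ} (ht : 0 ≤ t) :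
    Summable fun k : ℤ => |(k : ℝ)| ^ 6 * ‖a t k‖ ^ 2 :=
  summable_of_sum_le (fun _ => by positivity) (h.sobolev t ht)

lemma tsum_sobolev_le (h : IsSpectral M a₀ a) {t : ℝ} (ht : 0 ≤ t) :
    ∑' k : ℤ, |(k : ℝ)| ^ 6 * ‖a t k‖ ^ 2 ≤ M ^ 2 :=
  (h.summable_sobolev ht).tsum_le_of_sum_le (h.sobolev t ht)

lemma abs_mul_norm_le (h : IsSpectral M a₀ a) (hM : 0 ≤ M) {t : ℝ} (ht : 0 ≤ t) (k : ℤ) :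
    |(k : ℝ)| * ‖a t k‖ ≤ 8 * M * wt 2 k :=
  calc |(k : ℝ)| * ‖a t k‖ ≤ |(k : ℝ)| * (8 * M * wt 3 k) := by
        gcongr
        exact h.norm_le hM ht k
    _ = 8 * M * (|(k : ℝ)| * wt 3 k) := by ring
    _ ≤ _ := mul_le_mul_of_nonneg_left (abs_mul_wt_succ_le 2 k) (by positivity)

lemma summable_abs_mul_norm (h : IsSpectral M a₀ a) (hM : 0 ≤ M) {t : ℝ} (ht : 0 ≤ t) :
    Summable fun k : ℤ => |(k : ℝ)| * ‖a t k‖ :=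
  Summable.of_nonneg_of_le (fun _ => by positivity) (h.abs_mul_norm_le hM ht)
    ((summable_wt le_rfl).mul_left _)

/-- The rate in the Lipschitz bound of the `Ḣ³` energy in time. -/
def energyRate (M : ℝ) : ℝ := 448 * (M ^ 2 * (8 * M * wtSum 2) ^ 2) + 2 * M ^ 2

lemma abs_cutoff_energy_deriv_le (h : IsSpectral M a₀ a) (hM : 0 ≤ M) {n : ℕ} (hn : n ≠ 0) {t : ℝ}
    (ht : 0 ≤ t) :
    |∑ k ∈ freqs n, |(k : ℝ)| ^ 6 * cutoff n k * (2 * (starRingEnd ℂ (a t k) * rhs (a t) k).re)| ≤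
      energyRate M := by
  rw [sum_energy (freqs n) (fun k => |(k : ℝ)| ^ 6 * cutoff n k)]
  have hcut : ∀ k ∉ freqs n, cutoff n k = 0 := fun k => cutoff_eq_zero_of_notMem hn
  have hA := h.summable_abs_mul_norm hM ht
  have h1 := (isTame_cutoff hn).norm_energy_le (h.real t ht)
    (summable_of_ne_finset_zero (s := freqs n) fun k hk => by simp [hcut k hk])
    (h.summable_sobolev ht).hasSum hA.hasSum
  rw [tsum_eq_sum (s := freqs n) (fun k hk => by simp [hcut k hk])] at h1
  simp only [← mul_assoc, mul_abs_pow_six] 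
  have h2 := (Complex.abs_im_le_norm _).trans h1
  have h3 : (∑' k : ℤ, |(k : ℝ)| ^ 6 * ‖a t k‖ ^ 2) * (∑' k : ℤ, |(k : ℝ)| * ‖a t k‖) ^ 2 ≤
      M ^ 2 * (8 * M * wtSum 2) ^ 2 := by
    have e1 := h.tsum_sobolev_le ht
    have e2 : ∑' k : ℤ, |(k : ℝ)| * ‖a t k‖ ≤ 8 * M * wtSum 2 := by
      rw [wtSum, ← tsum_mul_left]
      exact hA.tsum_le_tsum (h.abs_mul_norm_le hM ht) ((summable_wt le_rfl).mul_left _)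
    have e3 : 0 ≤ ∑' k : ℤ, |(k : ℝ)| * ‖a t k‖ := tsum_nonneg fun _ => by positivity
    gcongr
  have h4 : ∑ k ∈ freqs n, |(k : ℝ)| ^ 6 * cutoff n k * (‖a t k‖ ^ 2 / |(k : ℝ)|) ≤ M ^ 2 := by
    refine (Finset.sum_le_sum fun k _ => ?_).trans (h.sobolev t ht (freqs n))
    have e : ‖a t k‖ ^ 2 / |(k : ℝ)| ≤ ‖a t k‖ ^ 2 := by
      rcases eq_or_ne k 0 with rfl | hk
      · simp
      · have : (1 : ℝ) ≤ |(k : ℝ)| := by exact_mod_cast Int.one_le_abs hk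
        exact div_le_self (sq_nonneg _) this
    have := cutoff_nonneg n k
    have := cutoff_le_one n k
    calc _ ≤ |(k : ℝ)| ^ 6 * 1 * ‖a t k‖ ^ 2 := by gcongr
      _ = _ := by ring
  have h5 : 0 ≤ ∑ k ∈ freqs n, |(k : ℝ)| ^ 6 * cutoff n k * (‖a t k‖ ^ 2 / |(k : ℝ)|) :=
    Finset.sum_nonneg fun k _ => by
      have := cutoff_nonneg n k
      positivity
  rw [abs_le] at h2 ⊢
  unfold energyRate
  constructor <;> linarith [h2.1, h2.2]

/-- `Ḣ³` regularity does not make `∑ |k|⁷|a_k|` finite, so the energy is not differentiated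
directly: the mean value inequality is applied to the finite cut-off sums, and then `n → ∞`. -/
lemma abs_sobolev_sub_le (h : IsSpectral M a₀ a) (hM : 0 ≤ M) {s t : ℝ} (hs : 0 ≤ s) (ht : 0 ≤ t) :
    |∑' k : ℤ, |(k : ℝ)| ^ 6 * ‖a t k‖ ^ 2 - ∑' k : ℤ, |(k : ℝ)| ^ 6 * ‖a s k‖ ^ 2| ≤
      energyRate M * |t - s| := by
  have hlim : ∀ t, 0 ≤ t → Tendsto
      (fun n : ℕ => ∑ k ∈ freqs n, |(k : ℝ)| ^ 6 * cutoff n k * ‖a t k‖ ^ 2) atTop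
      (𝓝 (∑' k : ℤ, |(k : ℝ)| ^ 6 * ‖a t k‖ ^ 2)) := by
    intro t ht
    have : Tendsto (fun n : ℕ => ∑' k : ℤ, |(k : ℝ)| ^ 6 * cutoff n k * ‖a t k‖ ^ 2) atTop
        (𝓝 (∑' k : ℤ, |(k : ℝ)| ^ 6 * ‖a t k‖ ^ 2)) := by
      refine tendsto_tsum_of_dominated_convergence (h.summable_sobolev ht) (fun k => ?_)
        (Eventually.of_forall fun n k => ?_)
      · simpa using ((tendsto_cutoff k).const_mul (|(k : ℝ)| ^ 6)).mul_const (‖a t k‖ ^ 2)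
      · have := cutoff_nonneg n k
        have := cutoff_le_one n k
        rw [norm_eq_abs, abs_of_nonneg (by positivity)]
        calc _ ≤ |(k : ℝ)| ^ 6 * 1 * ‖a t k‖ ^ 2 := by gcongr
          _ = _ := by ring
    refine this.congr' ?_
    filter_upwards [eventually_ne_atTop 0] with n hn
    exact tsum_eq_sum fun k hk => by simp [cutoff_eq_zero_of_notMem hn hk]
  refine le_of_tendsto ((hlim t ht).sub (hlim s hs)).abs ?_
  filter_upwards [eventually_ne_atTop 0] with n hn
  exact (convex_Ici 0).norm_image_sub_le_of_norm_hasDerivWithin_le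
    (fun r hr => hasDerivAt_weighted_energy fun k _ => h.deriv r hr k)
    (fun r hr => h.abs_cutoff_energy_deriv_le hM hn hr) hs ht

lemma tendsto_sobolev_sub (h : IsSpectral M a₀ a) (hM : 0 ≤ M) {t : ℝ} (ht : 0 ≤ t) :
    Tendsto (fun r => ∑' k : ℤ, |(k : ℝ)| ^ 6 * ‖a r k - a t k‖ ^ 2) (𝓝[Ici 0] t) (𝓝 0) := by
  refine tendsto_tsum_norm_sub_sq (fun _ => by positivity) ?_ (h.summable_sobolev ht)
    (h.tendsto_coeff ht) ?_
  · filter_upwards [self_mem_nhdsWithin] with r hr using h.summable_sobolev hr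
  · rw [tendsto_iff_dist_tendsto_zero]
    have hc : Tendsto (fun r => energyRate M * |r - t|) (𝓝[Ici 0] t) (𝓝 0) := by
      have : Continuous fun r => energyRate M * |r - t| := by fun_prop
      simpa using (this.tendsto t).mono_left nhdsWithin_le_nhds
    refine tendsto_of_tendsto_of_tendsto_of_le_of_le' tendsto_const_nhds hc
      (Eventually.of_forall fun _ => dist_nonneg) ?_
    filter_upwards [self_mem_nhdsWithin] with r hr
    exact h.abs_sobolev_sub_le hM ht hr

end IsSpectral

end

section

/-! ## Fourier synthesis -/

/-- The function with Fourier coefficients `a`. -/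
def synth (a : ℤ → ℂ) (x : Torus) : ℂ := ∑' k, a k * fourier k x

lemma norm_fourier_apply (k : ℤ) (x : Torus) : ‖fourier k x‖ = 1 := by
  rw [fourier_apply, Circle.norm_coe]

lemma norm_mul_fourier (z : ℂ) (k : ℤ) (x : Torus) : ‖z * fourier k x‖ = ‖z‖ := by
  rw [norm_mul, norm_fourier_apply, mul_one]

section

variable {a b : ℤ → ℂ}

lemma summable_synth (ha : Summable fun k => ‖a k‖) (x : Torus) :
    Summable fun k => a k * fourier k x :=
  Summable.of_norm (by simpa only [norm_mul_fourier] using ha)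

lemma continuous_synth (ha : Summable fun k => ‖a k‖) : Continuous (synth a) :=
  continuous_tsum (fun k => continuous_const.mul (fourier k).continuous) ha
    fun k x => (norm_mul_fourier (a k) k x).le

lemma fourierCoeff_synth (ha : Summable fun k => ‖a k‖) (n : ℤ) :
    fourierCoeff (synth a) n = a n := by
  have hint : ∀ k, ∫ x : Torus, fourier (-n) x * (a k * fourier k x) ∂AddCircle.haarAddCircle =
      if k = n then a k else 0 := by
    intro k
    have h1 := fourierCoeff.const_mul (T := 2 * π) (fourier k) (a k) n
    rw [fourierCoeff_fourier, Pi.single_apply] at h1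
    simp only [fourierCoeff, smul_eq_mul] at h1
    rw [h1, mul_ite, mul_one, mul_zero]
    simp only [eq_comm]
  have hc : ∀ k, Continuous fun x : Torus => fourier (-n) x * (a k * fourier k x) := fun k =>
    (fourier (-n)).continuous.mul (continuous_const.mul (fourier k).continuous)
  have h := hasSum_integral_of_summable_integral_norm
    (F := fun k (x : Torus) => fourier (-n) x * (a k * fourier k x))
    (μ := AddCircle.haarAddCircle (T := 2 * π))
    (fun k => (hc k).integrable_of_hasCompactSupport (HasCompactSupport.of_compactSpace _))
    (by simpa only [norm_mul, norm_fourier_apply, one_mul, mul_one, integral_const,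
      probReal_univ, one_smul] using ha)
  simp only [hint, tsum_mul_left] at h
  have he : (fun k => if k = n then a k else 0) = fun k => if k = n then a n else 0 := by
    funext k
    split_ifs with hk
    · rw [hk]
    · rfl
  rw [he] at h
  exact h.unique (hasSum_ite_eq n (a n))

lemma synth_sub (ha : Summable fun k => ‖a k‖) (hb : Summable fun k => ‖b k‖) (x : Torus) :
    synth (fun k => a k - b k) x = synth a x - synth b x := by
  simp only [synth, sub_mul]
  exact (summable_synth ha x).tsum_sub (summable_synth hb x)

lemma conj_synth (ha : IsRealSeq a) (x : Torus) : starRingEnd ℂ (synth a x) = synth a x := by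
  rw [synth, Complex.conj_tsum, ← (Equiv.neg ℤ).tsum_eq]
  refine tsum_congr fun k => ?_
  rw [Equiv.neg_apply, map_mul, ← ha.neg, ← fourier_neg, neg_neg]

lemma ofReal_re_synth (ha : IsRealSeq a) (x : Torus) : ((synth a x).re : ℂ) = synth a x :=
  Complex.conj_eq_iff_re.mp (conj_synth ha x)

lemma hasDerivAt_fourier_angle (k : ℤ) (α : ℝ) :
    HasDerivAt (fun α : ℝ => fourier k (α : Torus)) (Complex.I * k * fourier k (α : Torus)) α := by
  convert! hasDerivAt_fourier (2 * π) k α using 2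
  have : (π : ℂ) ≠ 0 := by exact_mod_cast pi_ne_zero
  push_cast
  field_simp

lemma summable_norm_deriv (ha' : Summable fun k : ℤ => |(k : ℝ)| * ‖a k‖) :
    Summable fun k : ℤ => ‖Complex.I * k * a k‖ := by
  simpa using ha'

lemma hasDerivAt_synth (ha : Summable fun k => ‖a k‖)
    (ha' : Summable fun k : ℤ => |(k : ℝ)| * ‖a k‖) (α : ℝ) :
    HasDerivAt (fun α : ℝ => synth a (α : Torus))
      (synth (fun k => Complex.I * k * a k) (α : Torus)) α := by
  refine hasDerivAt_tsum (g := fun k (α : ℝ) => a k * fourier k (α : Torus))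
    (g' := fun k (α : ℝ) => Complex.I * k * a k * fourier k (α : Torus)) (y₀ := 0) (summable_norm_deriv ha') (fun k α => ?_) (fun k α => ?_)
    (summable_synth ha _) α
  · exact ((hasDerivAt_fourier_angle k α).const_mul (a k)).congr_deriv (by ring)
  · rw [norm_mul_fourier]

lemma contDiff_synth (ha : Summable fun k => ‖a k‖)
    (ha' : Summable fun k : ℤ => |(k : ℝ)| * ‖a k‖)
    (ha'' : Summable fun k : ℤ => |(k : ℝ)| ^ 2 * ‖a k‖) :
    ContDiff ℝ 2 fun α : ℝ => synth a (α : Torus) := by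
  have h2 : Summable fun k : ℤ => |(k : ℝ)| * ‖Complex.I * k * a k‖ := by
    refine ha''.congr fun k => ?_
    rw [norm_mul, norm_mul, Complex.norm_I, Complex.norm_intCast]
    ring
  set b : ℤ → ℂ := fun k => Complex.I * k * a k with hb
  have hb0 : Summable fun k => ‖b k‖ := summable_norm_deriv ha'
  have hd : deriv (fun α : ℝ => synth a (α : Torus)) = fun α : ℝ => synth b (α : Torus) :=
    funext fun α => (hasDerivAt_synth ha ha' α).deriv
  have hd' : deriv (fun α : ℝ => synth b (α : Torus)) =
      fun α : ℝ => synth (fun k => Complex.I * k * b k) (α : Torus) :=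
    funext fun α => (hasDerivAt_synth hb0 h2 α).deriv
  have hc : ContDiff ℝ 1 fun α : ℝ => synth b (α : Torus) := by
    refine contDiff_one_iff_deriv.mpr ⟨fun α => (hasDerivAt_synth hb0 h2 α).differentiableAt, ?_⟩
    rw [hd']
    exact (continuous_synth (summable_norm_deriv h2)).comp (AddCircle.continuous_mk' _)
  refine (contDiff_succ_iff_deriv (n := 1)).mpr
    ⟨fun α => (hasDerivAt_synth ha ha' α).differentiableAt, by simp, ?_⟩
  rw [hd]
  exact hc

/-- Parametrization of three frequencies by their sum and the last two of them. -/
def sumEquiv : ℤ × ℤ × ℤ ≃ ℤ × ℤ × ℤ where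
  toFun y := (y.1 - y.2.1 - y.2.2, y.2)
  invFun y := (y.1 + y.2.1 + y.2.2, y.2)
  left_inv y := Prod.ext (by ring) rfl
  right_inv y := Prod.ext (by ring) rfl

lemma hasSum_triple_product {g : ℤ → ℂ} {s : ℂ} (h : HasSum g s) (hn : Summable fun k => ‖g k‖) :
    HasSum (fun k => ∑' p : ℤ × ℤ, g (k - p.1 - p.2) * (g p.1 * g p.2)) (s * (s * s)) := by
  have h1 : Summable fun y : ℤ × ℤ => ‖g y.1 * g y.2‖ := Summable.mul_norm hn hn
  have h2 : HasSum (fun y : ℤ × ℤ => g y.1 * g y.2) (s * s) := h.mul h h1.of_norm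
  have h3 : HasSum (fun y : ℤ × ℤ × ℤ => g y.1 * (g y.2.1 * g y.2.2)) (s * (s * s)) :=
    HasSum.mul (f := g) (g := fun y : ℤ × ℤ => g y.1 * g y.2) h h2
      (summable_mul_of_summable_norm (f := g) (g := fun y : ℤ × ℤ => g y.1 * g y.2) hn h1)
  -- Regrouping by the total frequency.
  have h4 : HasSum (fun y : ℤ × ℤ × ℤ => g (y.1 - y.2.1 - y.2.2) * (g y.2.1 * g y.2.2))
      (s * (s * s)) := sumEquiv.hasSum_iff.mpr h3
  exact h4.prod_fiberwise fun k => (h4.summable.prod_factor k).hasSum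

lemma tsum_conv3_mul {f : ℤ → ℂ} (hadd : ∀ k p q : ℤ, f (k - p - q) * (f p * f q) = f k)
    {s : ℂ} (h : HasSum (fun k => a k * f k) s) (hn : Summable fun k => ‖a k * f k‖) :
    ∑' k, conv3 a k * f k = s ^ 3 := by
  rw [pow_succ', sq, ← (hasSum_triple_product h hn).tsum_eq]
  refine tsum_congr fun k => ?_
  rw [conv3, ← tsum_mul_right]
  refine tsum_congr fun p => ?_
  rw [← hadd k p.1 p.2]
  ring

/-- The cube of a Fourier series. -/
lemma synth_conv3 (ha : Summable fun k => ‖a k‖) (x : Torus) :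
    synth (conv3 a) x = synth a x ^ 3 := by
  refine tsum_conv3_mul (f := fun k => fourier k x) (fun k p q => ?_) (summable_synth ha x).hasSum
    (by simpa only [norm_mul_fourier] using ha)
  rw [← fourier_add, ← fourier_add]
  congr 2
  ring

end

/-! ## Parseval and uniqueness of Fourier coefficients -/

lemma memLp_ofReal {f : Torus → ℝ} (hf : MemLp f 2 volume) :
    MemLp (fun x => (f x : ℂ)) 2 (AddCircle.haarAddCircle (T := 2 * π)) :=
  (MemLp.ofReal (K := ℂ) hf).haarAddCircle

lemma fourierBasis_repr_toLp {f : Torus → ℝ} (hf : MemLp f 2 volume) (k : ℤ) :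
    fourierBasis.repr ((memLp_ofReal hf).toLp _) k = coeff f k := by
  rw [fourierBasis_repr, coeff, fourierCoeff_congr_ae (memLp_ofReal hf).coeFn_toLp]

lemma ae_eq_of_coeff_eq {f g : Torus → ℝ} (hf : MemLp f 2 volume) (hg : MemLp g 2 volume)
    (h : ∀ k, coeff f k = coeff g k) : f =ᵐ[volume] g := by
  have h1 : (memLp_ofReal hf).toLp _ = (memLp_ofReal hg).toLp _ := by
    apply (fourierBasis (T := 2 * π)).repr.injective
    ext k
    rw [fourierBasis_repr_toLp hf, fourierBasis_repr_toLp hg, h]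
  have h2 := (MemLp.toLp_eq_toLp_iff _ _).mp h1
  rw [AddCircle.volume_eq_smul_haarAddCircle]
  refine Measure.ae_smul_measure ?_ _
  filter_upwards [h2] with x hx
  exact_mod_cast hx

/-- Parseval for the normalized Haar measure; passing to Lebesgue measure costs `√(2π)`. -/
lemma eLpNorm_le_of_sum_le {f : Torus → ℝ} (hf : MemLp f 2 volume) {B : ℝ} (hB : 0 ≤ B)
    (h : ∀ S : Finset ℤ, ∑ k ∈ S, ‖coeff f k‖ ^ 2 ≤ B ^ 2) :
    eLpNorm f 2 volume ≤ ENNReal.ofReal (√(2 * π) * B) := by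
  set F := (memLp_ofReal hf).toLp _
  have h1 : ‖F‖ ≤ B := by
    rw [← (fourierBasis (T := 2 * π)).repr.norm_map F]
    refine lp.norm_le_of_forall_sum_le (by norm_num) hB fun S => ?_
    simpa [F, fourierBasis_repr_toLp hf] using h S
  have h2 : eLpNorm (fun x => (f x : ℂ)) 2 (AddCircle.haarAddCircle (T := 2 * π)) ≤
      ENNReal.ofReal B := by
    rw [← ENNReal.ofReal_toReal (memLp_ofReal hf).2.ne, ← Lp.norm_toLp _ (memLp_ofReal hf)]
    exact ENNReal.ofReal_le_ofReal h1
  have h3 : eLpNorm f 2 volume = eLpNorm (fun x => (f x : ℂ)) 2 (volume : Measure Torus) :=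
    eLpNorm_congr_norm_ae (Eventually.of_forall fun x => by simp)
  rw [h3, AddCircle.volume_eq_smul_haarAddCircle, eLpNorm_smul_measure_of_ne_top (by norm_num),
    ENNReal.ofReal_mul (sqrt_nonneg _), smul_eq_mul]
  refine mul_le_mul' (le_of_eq ?_) h2
  rw [ENNReal.ofReal_rpow_of_nonneg (by positivity) (by norm_num), sqrt_eq_rpow]
  norm_num

end

/-! ## The logarithmic kernel -/

/-- The kernel of `Λ⁻¹`, up to a constant. -/
def logKernel (θ : ℝ) : ℝ := log (4 * sin (θ / 2) ^ 2)

/-- No sign condition is needed, as the real logarithm depends only on the absolute value and `log 0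
= 0`. -/
lemma logKernel_eq (θ : ℝ) : logKernel θ = 2 * log (2 * sin (θ / 2)) := by
  rw [logKernel, show 4 * sin (θ / 2) ^ 2 = (2 * sin (θ / 2)) ^ 2 by ring, log_pow]
  norm_num

lemma intervalIntegrable_logKernel (a b : ℝ) : IntervalIntegrable logKernel volume a b := by
  have h : AnalyticOnNhd ℝ (fun θ : ℝ => 4 * sin (θ / 2) ^ 2) univ := by
    intro x _
    fun_prop
  exact (h.meromorphicOn.mono_set (subset_univ _)).intervalIntegrable_log

lemma intervalIntegrable_ofReal_logKernel (a b : ℝ) :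
    IntervalIntegrable (fun θ => (logKernel θ : ℂ)) volume a b :=
  ⟨(intervalIntegrable_logKernel a b).1.ofReal, (intervalIntegrable_logKernel a b).2.ofReal⟩

lemma periodic_logKernel : Function.Periodic logKernel (2 * π) := by
  intro θ
  rw [logKernel, logKernel, show (θ + 2 * π) / 2 = θ / 2 + π by ring, sin_add_pi, neg_sq]

lemma integral_logKernel : ∫ θ in (0 : ℝ)..2 * π, logKernel θ = 0 := by
  have h1 : ∫ θ in (0 : ℝ)..2 * π, logKernel θ =
      ∫ θ in (0 : ℝ)..2 * π, (fun x => 2 * log 2 + 2 * log (sin x)) (θ / 2) := by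
    rw [intervalIntegral.integral_of_le (by positivity), intervalIntegral.integral_of_le
      (by positivity), integral_Ioc_eq_integral_Ioo, integral_Ioc_eq_integral_Ioo]
    refine setIntegral_congr_fun measurableSet_Ioo fun θ hθ => ?_
    have hs : 0 < sin (θ / 2) := sin_pos_of_pos_of_lt_pi (by linarith [hθ.1]) (by linarith [hθ.2])
    simp only [logKernel_eq]
    rw [log_mul two_ne_zero hs.ne']
    ring
  have hint : IntervalIntegrable (fun x => log (sin x)) volume 0 π := intervalIntegrable_log_sin
  rw [h1, intervalIntegral.integral_comp_div (fun x => 2 * log 2 + 2 * log (sin x)) two_ne_zero,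
    zero_div,
    mul_div_cancel_left₀ _ two_ne_zero, intervalIntegral.integral_add (by simp)
    (hint.const_mul 2), intervalIntegral.integral_const_mul,
    intervalIntegral.integral_const_mul, integral_log_sin_zero_pi]
  simp
  ring

/-- The half-angle exponential `e^{-iθ/2}`. -/
def halfExp (θ : ℝ) : ℂ := (cos (θ / 2) : ℂ) - (sin (θ / 2) : ℂ) * Complex.I

lemma halfExp_sq_sub_one (θ : ℝ) :
    halfExp θ ^ 2 - 1 = -2 * Complex.I * (sin (θ / 2) : ℂ) * halfExp θ := by
  have h : ((cos (θ / 2) : ℂ)) ^ 2 = 1 - (sin (θ / 2) : ℂ) ^ 2 := by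
    rw [eq_sub_iff_add_eq]; exact_mod_cast cos_sq_add_sin_sq _
  simp only [halfExp]
  linear_combination h - (sin (θ / 2) : ℂ) ^ 2 * Complex.I_sq

lemma halfExp_sq_add_one (θ : ℝ) :
    halfExp θ ^ 2 + 1 = 2 * (cos (θ / 2) : ℂ) * halfExp θ := by
  have h : ((cos (θ / 2) : ℂ)) ^ 2 = 1 - (sin (θ / 2) : ℂ) ^ 2 := by
    rw [eq_sub_iff_add_eq]; exact_mod_cast cos_sq_add_sin_sq _
  simp only [halfExp]
  linear_combination -h + (sin (θ / 2) : ℂ) ^ 2 * Complex.I_sq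

lemma halfExp_sq (θ : ℝ) : halfExp θ ^ 2 = Complex.exp (-(θ * Complex.I)) := by
  have : halfExp θ = Complex.exp (-(θ / 2 : ℝ) * Complex.I) := by
    rw [Complex.exp_mul_I, Complex.cos_neg, Complex.sin_neg, halfExp]
    push_cast
    ring
  rw [this, ← Complex.exp_nat_mul]
  congr 1
  push_cast
  ring

lemma exp_neg_pow (k : ℕ) (θ : ℝ) :
    Complex.exp (-(θ * Complex.I)) ^ k = Complex.exp (-(k * Complex.I) * θ) := by
  rw [← Complex.exp_nat_mul]
  congr 1
  ring

lemma integral_exp_pow (k : ℕ) :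
    ∫ θ in (0 : ℝ)..2 * π, Complex.exp (-(θ * Complex.I)) ^ k = if k = 0 then (2 * π : ℂ) else 0 := by
  split_ifs with hk
  · simp [hk]
  · simp_rw [exp_neg_pow]
    have hc : -((k : ℂ) * Complex.I) ≠ 0 := by simp [hk, Complex.I_ne_zero]
    rw [integral_exp_mul_complex hc]
    have : Complex.exp (-(k * Complex.I) * ((2 * π : ℝ) : ℂ)) = 1 := by
      rw [Complex.exp_eq_one_iff]
      exact ⟨-k, by push_cast; ring⟩
    rw [this]
    simp

/-- A primitive of `logKernel θ * e^{-ikθ}`, up to a trigonometric polynomial. -/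
def kernelPrimitive (k : ℕ) (θ : ℝ) : ℂ :=
  2 / k * ((2 * sin (θ / 2) * log (2 * sin (θ / 2)) : ℝ) : ℂ) * halfExp θ *
    ∑ j ∈ Finset.range k, Complex.exp (-(θ * Complex.I)) ^ j

lemma continuous_kernelPrimitive (k : ℕ) : Continuous (kernelPrimitive k) := by
  have h : Continuous fun θ : ℝ => 2 * sin (θ / 2) * log (2 * sin (θ / 2)) :=
    continuous_mul_log.comp (by fun_prop : Continuous fun θ : ℝ => 2 * sin (θ / 2))
  unfold kernelPrimitive halfExp
  fun_prop

/-- The definition, through `x log x`, shows continuity at the singular endpoints; this form is the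
one to differentiate. Subtracting 1 from `e^{-ikθ}` is what kills the singularity of the logarithm.
-/
lemma kernelPrimitive_eq {k : ℕ} (hk : k ≠ 0) (θ : ℝ) :
    kernelPrimitive k θ = (logKernel θ : ℂ) *
      ((Complex.exp (-(θ * Complex.I)) ^ k - 1) * (Complex.I / k)) := by
  have hk' : (k : ℂ) ≠ 0 := by exact_mod_cast hk
  rw [← geom_sum_mul, ← halfExp_sq, halfExp_sq_sub_one, kernelPrimitive, logKernel_eq, ← halfExp_sq]
  simp only [Complex.ofReal_mul, Complex.ofReal_ofNat]
  generalize ∑ j ∈ Finset.range k, (halfExp θ ^ 2) ^ j = S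
  field_simp
  linear_combination ((sin (θ / 2) : ℂ) * (log (2 * sin (θ / 2)) : ℂ) * halfExp θ * S) *
    Complex.I_sq

lemma hasDerivAt_kernelPrimitive {k : ℕ} (hk : k ≠ 0) {θ : ℝ} (hs : sin (θ / 2) ≠ 0) :
    HasDerivAt (kernelPrimitive k) ((logKernel θ : ℂ) * Complex.exp (-(θ * Complex.I)) ^ k +
      1 / k * ((1 + Complex.exp (-(θ * Complex.I))) *
        ∑ j ∈ Finset.range k, Complex.exp (-(θ * Complex.I)) ^ j)) θ := by
  have hk' : (k : ℂ) ≠ 0 := by exact_mod_cast hk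
  have hs' : (sin (θ / 2) : ℂ) ≠ 0 := by exact_mod_cast hs
  have e1 : HasDerivAt logKernel (cos (θ / 2) / sin (θ / 2)) θ := by
    rw [funext logKernel_eq]
    have h1 : HasDerivAt (fun θ : ℝ => 2 * sin (θ / 2)) (2 * (cos (θ / 2) * (1 / 2))) θ :=
      (((hasDerivAt_id θ).div_const 2).sin).const_mul 2
    refine ((h1.log (by simpa using hs)).const_mul 2).congr_deriv ?_
    field_simp
  have e2 : HasDerivAt (fun θ : ℝ => Complex.exp (-(θ * Complex.I)) ^ k)
      (-(k * Complex.I) * Complex.exp (-(θ * Complex.I)) ^ k) θ := by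
    simp_rw [exp_neg_pow]
    have h1 : HasDerivAt (fun θ : ℝ => -(k * Complex.I) * (θ : ℂ)) (-(k * Complex.I)) θ := by
      simpa using (Complex.ofRealCLM.hasDerivAt (x := θ)).const_mul (-(k * Complex.I))
    refine h1.cexp.congr_deriv ?_
    ring
  rw [funext (kernelPrimitive_eq hk)]
  refine (e1.ofReal_comp.mul ((e2.sub_const 1).mul_const (Complex.I / k))).congr_deriv ?_
  rw [← geom_sum_mul, ← halfExp_sq, add_comm (1 : ℂ), halfExp_sq_add_one, halfExp_sq_sub_one]
  generalize ∑ j ∈ Finset.range k, (halfExp θ ^ 2) ^ j = S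
  rw [Complex.ofReal_div]
  field_simp
  rw [Complex.I_sq]
  ring

lemma integral_logKernel_mul_pow {k : ℕ} (hk : k ≠ 0) :
    ∫ θ in (0 : ℝ)..2 * π, (logKernel θ : ℂ) * Complex.exp (-(θ * Complex.I)) ^ k =
      -(2 * π / k) := by
  have hi1 : IntervalIntegrable
      (fun θ : ℝ => (logKernel θ : ℂ) * Complex.exp (-(θ * Complex.I)) ^ k) volume 0 (2 * π) :=
    (intervalIntegrable_ofReal_logKernel _ _).mul_continuousOn (by fun_prop)
  have hc : Continuous fun θ : ℝ => 1 / (k : ℂ) * ((1 + Complex.exp (-(θ * Complex.I))) *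
        ∑ j ∈ Finset.range k, Complex.exp (-(θ * Complex.I)) ^ j) := by fun_prop
  have h := intervalIntegral.integral_eq_sub_of_hasDerivAt_of_le (a := 0) (b := 2 * π)
    (by positivity) (continuous_kernelPrimitive k).continuousOn (fun θ hθ =>
      hasDerivAt_kernelPrimitive hk (sin_pos_of_pos_of_lt_pi (by linarith [hθ.1])
        (by linarith [hθ.2])).ne') (hi1.add (hc.intervalIntegrable _ _))
  rw [intervalIntegral.integral_add hi1 (hc.intervalIntegrable _ _),
    intervalIntegral.integral_const_mul] at h
  -- Only the constant term of this trigonometric polynomial has nonzero integral.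
  have h2 : ∫ θ in (0 : ℝ)..2 * π, ((1 + Complex.exp (-(θ * Complex.I))) *
        ∑ j ∈ Finset.range k, Complex.exp (-(θ * Complex.I)) ^ j) = 2 * π := by
    have e : ∀ θ : ℝ, (1 + Complex.exp (-(θ * Complex.I))) *
        ∑ j ∈ Finset.range k, Complex.exp (-(θ * Complex.I)) ^ j =
        ∑ j ∈ Finset.range k, (Complex.exp (-(θ * Complex.I)) ^ j +
          Complex.exp (-(θ * Complex.I)) ^ (j + 1)) := by
      intro θ
      rw [Finset.mul_sum]
      refine Finset.sum_congr rfl fun j _ => ?_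
      ring
    have hii : ∀ j : ℕ, IntervalIntegrable (fun θ : ℝ => Complex.exp (-(θ * Complex.I)) ^ j)
        volume 0 (2 * π) := fun j => by
      apply Continuous.intervalIntegrable
      fun_prop
    simp_rw [e]
    rw [intervalIntegral.integral_finsetSum fun j _ => (hii j).add (hii (j + 1))]
    simp_rw [intervalIntegral.integral_add (hii _) (hii _), integral_exp_pow]
    simp [Nat.pos_of_ne_zero hk]
  have h3 : kernelPrimitive k (2 * π) = 0 := by
    rw [kernelPrimitive, mul_div_cancel_left₀ _ two_ne_zero]
    simp
  have h4 : kernelPrimitive k 0 = 0 := by simp [kernelPrimitive]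
  rw [h2, h3, h4] at h
  linear_combination h

lemma fourier_angle (k : ℤ) (θ : ℝ) :
    fourier k (θ : Torus) = Complex.exp (k * Complex.I * θ) := by
  rw [fourier_coe_apply]
  congr 1
  have : (π : ℂ) ≠ 0 := by exact_mod_cast pi_ne_zero
  push_cast
  field_simp

lemma fourier_two_pi_sub (k : ℤ) (θ : ℝ) :
    fourier k ((2 * π - θ : ℝ) : Torus) = fourier (-k) (θ : Torus) := by
  rw [AddCircle.coe_sub, AddCircle.coe_period, zero_sub, fourier_apply, fourier_apply, smul_neg,
    neg_smul]

/-- The Fourier coefficients of the logarithmic kernel. -/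
lemma integral_logKernel_mul_fourier (k : ℤ) :
    ∫ θ in (0 : ℝ)..2 * π, (logKernel θ : ℂ) * fourier k (θ : Torus) =
      -(2 * π / (|(k : ℝ)| : ℝ)) := by
  have hneg : ∀ n : ℕ, ∫ θ in (0 : ℝ)..2 * π, (logKernel θ : ℂ) * fourier (-(n : ℤ)) (θ : Torus) =
      -(2 * π / n) := by
    intro n
    rcases eq_or_ne n 0 with rfl | hn
    -- The convention `x / 0 = 0` agrees with the zero mean of the kernel.
    · simp only [Nat.cast_zero, neg_zero, fourier_zero, mul_one, div_zero]
      rw [intervalIntegral.integral_ofReal, integral_logKernel, Complex.ofReal_zero]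
    · rw [← integral_logKernel_mul_pow hn]
      refine intervalIntegral.integral_congr fun θ _ => ?_
      simp only [fourier_angle, exp_neg_pow]
      congr 2
      push_cast
      ring
  have hsymm : ∀ k : ℤ, ∫ θ in (0 : ℝ)..2 * π, (logKernel θ : ℂ) * fourier k (θ : Torus) =
      ∫ θ in (0 : ℝ)..2 * π, (logKernel θ : ℂ) * fourier (-k) (θ : Torus) := by
    intro k
    have h := intervalIntegral.integral_comp_sub_left (a := 0) (b := 2 * π)
      (fun θ : ℝ => (logKernel θ : ℂ) * fourier k (θ : Torus)) (2 * π)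
    rw [sub_self, sub_zero] at h
    rw [← h]
    refine intervalIntegral.integral_congr fun θ _ => ?_
    have hK : logKernel (2 * π - θ) = logKernel θ := by
      rw [logKernel, logKernel, show (2 * π - θ) / 2 = π - θ / 2 by ring, sin_pi_sub]
    simp only [fourier_two_pi_sub, hK]
  obtain ⟨n, rfl | rfl⟩ := Int.eq_nat_or_neg k
  · rw [hsymm, hneg]
    simp
  · rw [hneg]
    simp

lemma integral_logKernel_sub_mul_fourier (k : ℤ) (α : ℝ) :
    ∫ β in (-π)..π, (logKernel (α - β) : ℂ) * fourier k (β : Torus) =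
      -(2 * π / (|(k : ℝ)| : ℝ)) * fourier k (α : Torus) := by
  set g : ℝ → ℂ := fun θ => fourier k (α : Torus) * ((logKernel θ : ℂ) * fourier (-k) (θ : Torus))
  have hg : Function.Periodic g (2 * π) := by
    intro θ
    simp only [g, periodic_logKernel θ, AddCircle.coe_add_period]
  have h1 : ∀ β : ℝ, (logKernel (α - β) : ℂ) * fourier k (β : Torus) = g (α - β) := by
    intro β
    have : (fourier k (β : Torus) : ℂ) =
        fourier k (α : Torus) * fourier (-k) ((α - β : ℝ) : Torus) := by
      simp only [fourier_angle, ← Complex.exp_add]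
      congr 1
      push_cast
      ring
    simp only [g]
    rw [this]
    ring
  simp_rw [h1]
  rw [intervalIntegral.integral_comp_sub_left g α, show α - -π = α - π + 2 * π by ring,
    hg.intervalIntegral_add_eq (α - π) 0, zero_add, intervalIntegral.integral_const_mul,
    integral_logKernel_mul_fourier, Int.cast_neg, abs_neg, mul_comm]

/-- `Λ⁻¹` divides the coefficients by `|k|`. -/
lemma lambdaInv_synth {a : ℤ → ℂ} (hr : IsRealSeq a) (ha : Summable fun k => ‖a k‖) (α : ℝ) :
    LambdaInv (fun x => (synth a x).re) α =
      (synth (fun k => a k / (|(k : ℝ)| : ℝ)) (α : Torus)).re := by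
  have hK : IntervalIntegrable (fun β => (logKernel (α - β) : ℂ)) volume (-π) π := by
    have := (intervalIntegrable_ofReal_logKernel (α + π) (α - π)).comp_sub_left α
    simpa using this
  have hle : -π ≤ π := by linarith [pi_pos]
  have hF : ∀ k : ℤ, IntervalIntegrable
      (fun β : ℝ => (logKernel (α - β) : ℂ) * (a k * fourier k (β : Torus))) volume (-π) π :=
    fun k => hK.mul_continuousOn (continuous_const.mul ((fourier k).continuous.comp
      (AddCircle.continuous_mk' _))).continuousOn
  have hn : ∀ k : ℤ, ∫ β in Ioc (-π) π, ‖(logKernel (α - β) : ℂ) * (a k * fourier k (β : Torus))‖ =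
      (∫ β in Ioc (-π) π, ‖(logKernel (α - β) : ℂ)‖) * ‖a k‖ := by
    intro k
    -- Characters have modulus 1, so integrability of the kernel and summability of `a` justify
    -- exchanging sum and integral.
    rw [← integral_mul_const]
    simp only [norm_mul, norm_fourier_apply, mul_one]
  have h := hasSum_integral_of_summable_integral_norm (μ := volume.restrict (Ioc (-π) π))
    (F := fun (k : ℤ) (β : ℝ) => (logKernel (α - β) : ℂ) * (a k * fourier k (β : Torus)))
    (fun k => (intervalIntegrable_iff_integrableOn_Ioc_of_le hle).mp (hF k))
    (by simp only [hn]; exact ha.mul_left _)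
  have h1 : ∀ k : ℤ, ∫ β in Ioc (-π) π, (logKernel (α - β) : ℂ) * (a k * fourier k (β : Torus)) =
      -(2 * π) * (a k / (|(k : ℝ)| : ℝ) * fourier k (α : Torus)) := by
    intro k
    rw [← intervalIntegral.integral_of_le hle]
    simp_rw [mul_left_comm _ (a k)]
    rw [intervalIntegral.integral_const_mul, integral_logKernel_sub_mul_fourier]
    ring
  have h2 : ∫ β in Ioc (-π) π, ∑' k : ℤ, (logKernel (α - β) : ℂ) * (a k * fourier k (β : Torus)) =
      ((∫ β in (-π)..π, logKernel (α - β) * (synth a (β : Torus)).re : ℝ) : ℂ) := by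
    rw [← intervalIntegral.integral_ofReal, intervalIntegral.integral_of_le hle]
    refine setIntegral_congr_fun measurableSet_Ioc fun β _ => ?_
    simp only [tsum_mul_left]
    rw [Complex.ofReal_mul, ofReal_re_synth hr]
    rfl
  rw [h2] at h
  simp only [h1] at h
  have h3 := h.tsum_eq
  rw [tsum_mul_left] at h3
  have h4 : (LambdaInv (fun x => (synth a x).re) α : ℂ) =
      synth (fun k => a k / (|(k : ℝ)| : ℝ)) (α : Torus) := by
    change ((-(1 / (2 * π)) * ∫ β in (-π)..π, logKernel (α - β) * (synth a (β : Torus)).re : ℝ) : ℂ)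
      = _
    have hc : ((-(1 / (2 * π)) : ℝ) : ℂ) * -(2 * π) = 1 := by
      have : (π : ℂ) ≠ 0 := by exact_mod_cast pi_ne_zero
      push_cast
      field_simp
    rw [Complex.ofReal_mul, ← h3, ← mul_assoc, hc, one_mul]
    rfl
  rw [← h4, Complex.ofReal_re]

section

/-! ## The solution -/

lemma coeff_re_synth {a : ℤ → ℂ} (hr : IsRealSeq a) (ha : Summable fun k => ‖a k‖) (k : ℤ) :
    coeff (fun x => (synth a x).re) k = a k := by
  rw [coeff, ← fourierCoeff_synth ha k]
  congr 1
  funext x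
  exact ofReal_re_synth hr x

lemma memLp_re_synth {a : ℤ → ℂ} (ha : Summable fun k => ‖a k‖) :
    MemLp (fun x => (synth a x).re) 2 (volume : Measure Torus) :=
  (Complex.continuous_re.comp (continuous_synth ha)).memLp_of_hasCompactSupport
    (HasCompactSupport.of_compactSpace _)

lemma IsRealSeq.sub {a b : ℤ → ℂ} (ha : IsRealSeq a) (hb : IsRealSeq b) :
    IsRealSeq fun k => a k - b k where
  zero := by rw [ha.zero, hb.zero, sub_zero]
  neg k := by rw [ha.neg, hb.neg, map_sub]

/-- Zero mean removes `k = 0`, and `1 + k² ≤ 2k²` elsewhere. -/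
lemma sobolev_weight_le {a : ℤ → ℂ} (ha : IsRealSeq a) (k : ℤ) :
    (1 + (k : ℝ) ^ 2) ^ 3 * ‖a k‖ ^ 2 ≤ 8 * (|(k : ℝ)| ^ 6 * ‖a k‖ ^ 2) := by
  rcases eq_or_ne k 0 with rfl | hk
  · simp [ha.zero]
  · have h1 : (1 : ℝ) ≤ |(k : ℝ)| := by exact_mod_cast Int.one_le_abs hk
    have h2 : 1 + (k : ℝ) ^ 2 ≤ 2 * |(k : ℝ)| ^ 2 := by
      rw [← sq_abs (k : ℝ)]
      nlinarith
    calc (1 + (k : ℝ) ^ 2) ^ 3 * ‖a k‖ ^ 2 ≤ (2 * |(k : ℝ)| ^ 2) ^ 3 * ‖a k‖ ^ 2 := by gcongr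
      _ = _ := by ring

lemma IsRealSeq.memH {a : ℤ → ℂ} (hr : IsRealSeq a) (ha : Summable fun k => ‖a k‖)
    (hs : Summable fun k : ℤ => |(k : ℝ)| ^ 6 * ‖a k‖ ^ 2) :
    MemH 3 fun x => (synth a x).re := by
  refine ⟨memLp_re_synth ha, ?_⟩
  simp only [coeff_re_synth hr ha]
  exact Summable.of_nonneg_of_le (fun _ => by positivity) (sobolev_weight_le hr) (hs.mul_left 8)

lemma IsRealSeq.normH_le {a : ℤ → ℂ} (hr : IsRealSeq a) (ha : Summable fun k => ‖a k‖)
    (hs : Summable fun k : ℤ => |(k : ℝ)| ^ 6 * ‖a k‖ ^ 2) :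
    normH 3 (fun x => (synth a x).re) ≤ √(8 * ∑' k : ℤ, |(k : ℝ)| ^ 6 * ‖a k‖ ^ 2) := by
  have h := (hr.memH ha hs).2
  simp only [coeff_re_synth hr ha] at h
  unfold normH
  simp only [coeff_re_synth hr ha]
  rw [← tsum_mul_left]
  exact sqrt_le_sqrt (h.tsum_le_tsum (sobolev_weight_le hr) (hs.mul_left 8))

namespace IsSpectral

variable {M : ℝ} {a₀ : ℤ → ℂ} {a : ℝ → ℤ → ℂ}

lemma summable_norm (h : IsSpectral M a₀ a) (hM : 0 ≤ M) {t : ℝ} (ht : 0 ≤ t) :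
    Summable fun k => ‖a t k‖ :=
  (h.real t ht).summable_norm (h.summable_abs_mul_norm hM ht)

/-- The pointwise decay `wt 3` would only give the divergent bound `1/|k|`. The `ℓ²` information is
used instead, paired with `|k|⁻¹`. -/
lemma summable_sq_mul_norm (h : IsSpectral M a₀ a) {t : ℝ} (ht : 0 ≤ t) :
    Summable fun k : ℤ => |(k : ℝ)| ^ 2 * ‖a t k‖ := by
  have h1 : Summable fun k : ℤ => (|(k : ℝ)| ^ 2)⁻¹ :=
    Summable.of_nat_of_neg (by simp) (by simp)
  refine Summable.of_nonneg_of_le (fun _ => by positivity) (fun k => ?_)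
    ((h.summable_sobolev ht).add h1)
  rcases eq_or_ne k 0 with rfl | hk
  · simp
  · have hk' : |(k : ℝ)| ≠ 0 := by simpa using hk
    have e1 : |(k : ℝ)| ^ 2 * ‖a t k‖ = (|(k : ℝ)| ^ 3 * ‖a t k‖) * |(k : ℝ)|⁻¹ := by field_simp
    have e2 := two_mul_le_add_sq (|(k : ℝ)| ^ 3 * ‖a t k‖) |(k : ℝ)|⁻¹
    have e3 : 0 ≤ (|(k : ℝ)| ^ 3 * ‖a t k‖) * |(k : ℝ)|⁻¹ := by positivity
    rw [e1, ← inv_pow]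
    calc _ ≤ (|(k : ℝ)| ^ 3 * ‖a t k‖) ^ 2 + |(k : ℝ)|⁻¹ ^ 2 := by linarith
      _ = _ := by ring

lemma summable_conv3 (h : IsSpectral M a₀ a) (hM : 0 ≤ M) {t : ℝ} (ht : 0 ≤ t) :
    Summable fun k => ‖conv3 (a t) k‖ :=
  Summable.of_nonneg_of_le (fun _ => norm_nonneg _) (norm_conv3_le_of_decay (h.norm_le hM ht))
    ((summable_wt (by norm_num)).mul_left _)

lemma summable_abs_mul_conv3 (h : IsSpectral M a₀ a) (hM : 0 ≤ M) {t : ℝ} (ht : 0 ≤ t) :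
    Summable fun k : ℤ => |(k : ℝ)| * ‖conv3 (a t) k‖ := by
  refine Summable.of_nonneg_of_le (fun _ => by positivity) (fun k => ?_)
    ((summable_wt (s := 2) le_rfl).mul_left (81 * (8 * M) ^ 3 * wtSum 3 ^ 2))
  calc |(k : ℝ)| * ‖conv3 (a t) k‖ ≤ |(k : ℝ)| * (81 * (8 * M) ^ 3 * wtSum 3 ^ 2 * wt 3 k) := by
        gcongr
        exact norm_conv3_le_of_decay (h.norm_le hM ht) k
    _ = 81 * (8 * M) ^ 3 * wtSum 3 ^ 2 * (|(k : ℝ)| * wt 3 k) := by ring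
    _ ≤ _ := mul_le_mul_of_nonneg_left (abs_mul_wt_succ_le 2 k) (by positivity)

/-- The Lipschitz bounds of the coefficients, with weight `wt 2`, dominate the difference quotients.
-/
lemma hasDerivWithinAt_synth (h : IsSpectral M a₀ a) (hM : 0 ≤ M) {t : ℝ} (ht : 0 ≤ t) (x : Torus) :
    HasDerivWithinAt (fun r => synth (a r) x) (synth (rhs (a t)) x) (Ici 0) t := by
  rw [hasDerivWithinAt_iff_tendsto_slope]
  have h1 : Tendsto (fun r => ∑' k, slope (fun r => a r k) t r * fourier k x) (𝓝[Ici 0 \ {t}] t)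
      (𝓝 (∑' k, rhs (a t) k * fourier k x)) := by
    refine tendsto_tsum_of_dominated_convergence ((summable_wt (s := 2) le_rfl).mul_left (lipRate M))
      (fun k => (hasDerivWithinAt_iff_tendsto_slope.mp (h.deriv t ht k)).mul_const _) ?_
    filter_upwards [self_mem_nhdsWithin] with r hr k
    have hne : |r - t| ≠ 0 := abs_ne_zero.mpr (sub_ne_zero.mpr hr.2)
    rw [norm_mul_fourier, slope, vsub_eq_sub, norm_smul, norm_inv, norm_eq_abs]
    calc |r - t|⁻¹ * ‖a r k - a t k‖ ≤ |r - t|⁻¹ * (lipRate M * wt 2 k * |r - t|) := by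
          gcongr
          exact h.lipschitz hM ht hr.1 k
      _ = _ := by field_simp
  refine h1.congr' ?_
  filter_upwards [self_mem_nhdsWithin] with r hr
  simp only [slope, vsub_eq_sub]
  rw [← synth_sub (h.summable_norm hM hr.1) (h.summable_norm hM ht), synth, ← tsum_const_smul'']
  refine tsum_congr fun k => ?_
  rw [smul_mul_assoc]

/-- The equation in terms of Fourier series. -/
lemma synth_rhs (h : IsSpectral M a₀ a) (hM : 0 ≤ M) {t : ℝ} (ht : 0 ≤ t) (α : ℝ) :
    synth (rhs (a t)) α + synth (a t) α ^ 2 * synth (fun k => Complex.I * k * a t k) α =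
      -synth (fun k => a t k / (|(k : ℝ)| : ℝ)) α := by
  have hs := h.summable_norm hM ht
  have h1 := hasDerivAt_synth (h.summable_conv3 hM ht) (h.summable_abs_mul_conv3 hM ht) α
  rw [funext fun α : ℝ => synth_conv3 hs (α : Torus)] at h1
  -- The series of `conv3` is the cube, so its termwise derivative must equal `3 u² u_α`.
  have h2 := h1.unique ((hasDerivAt_synth hs (h.summable_abs_mul_norm hM ht) α).pow 3)
  have h3 : Summable fun k : ℤ => ‖-(Complex.I * k / 3) * conv3 (a t) k‖ := by
    refine ((h.summable_abs_mul_conv3 hM ht).mul_left (1 / 3)).congr fun k => ?_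
    simp
    ring
  have h4 : Summable fun k : ℤ => ‖a t k / (|(k : ℝ)| : ℝ)‖ := by
    refine Summable.of_nonneg_of_le (fun _ => norm_nonneg _) (fun k => ?_) hs
    rcases eq_or_ne k 0 with rfl | hk
    · simp
    · have : (1 : ℝ) ≤ |(k : ℝ)| := by exact_mod_cast Int.one_le_abs hk
      rw [norm_div, Complex.norm_real, norm_eq_abs, abs_abs]
      exact div_le_self (norm_nonneg _) this
  have h5 : synth (rhs (a t)) α = synth (fun k : ℤ => -(Complex.I * k / 3) * conv3 (a t) k) α -
      synth (fun k => a t k / (|(k : ℝ)| : ℝ)) α := synth_sub h3 h4 α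
  have h6 : synth (fun k : ℤ => -(Complex.I * k / 3) * conv3 (a t) k) α =
      -(1 / 3) * synth (fun k : ℤ => Complex.I * k * conv3 (a t) k) α := by
    rw [synth, synth, ← tsum_mul_left]
    refine tsum_congr fun k => ?_
    ring
  rw [h5, h6, h2]
  norm_num
  ring

lemma isSolution (h : IsSpectral M a₀ a) (hM : 0 ≤ M) {u₀ : Torus → ℝ} (hu₀ : MemLp u₀ 2 volume)
    (ha₀ : ∀ k, coeff u₀ k = a₀ k) (T : ℝ) :
    IsSolution T u₀ fun t x => (synth (a t) x).re where
  continuousInH := by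
    refine ⟨fun t ht => (h.real t ht.1).memH (h.summable_norm hM ht.1) (h.summable_sobolev ht.1),
      fun t ht => ?_⟩
    have h1 := ((h.tendsto_sobolev_sub hM ht.1).const_mul 8).sqrt
    rw [mul_zero, sqrt_zero] at h1
    refine tendsto_of_tendsto_of_tendsto_of_le_of_le' tendsto_const_nhds
      (h1.mono_left (nhdsWithin_mono t Icc_subset_Ici_self))
      (Eventually.of_forall fun _ => sqrt_nonneg _) ?_
    filter_upwards [self_mem_nhdsWithin] with r hr
    have hsr := h.summable_norm hM hr.1
    have hst := h.summable_norm hM ht.1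
    have e : ((fun x => (synth (a r) x).re) - fun x => (synth (a t) x).re) =
        fun x => (synth (fun k => a r k - a t k) x).re := by
      funext x
      rw [synth_sub hsr hst, Complex.sub_re, Pi.sub_apply]
    rw [e]
    refine ((h.real r hr.1).sub (h.real t ht.1)).normH_le
      (Summable.of_nonneg_of_le (fun _ => norm_nonneg _) (fun k => norm_sub_le _ _) (hsr.add hst)) ?_
    refine Summable.of_nonneg_of_le (fun _ => by positivity) (fun k => ?_)
      (((h.summable_sobolev hr.1).add (h.summable_sobolev ht.1)).mul_left 2)
    have h2 : ‖a r k - a t k‖ ^ 2 ≤ 2 * (‖a r k‖ ^ 2 + ‖a t k‖ ^ 2) :=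
      (pow_le_pow_left₀ (norm_nonneg _) (norm_sub_le _ _) 2).trans add_sq_le
    calc _ ≤ |(k : ℝ)| ^ 6 * (2 * (‖a r k‖ ^ 2 + ‖a t k‖ ^ 2)) := by gcongr
      _ = _ := by ring
  contDiff t ht := Complex.reCLM.contDiff.comp (contDiff_synth (h.summable_norm hM ht.1)
    (h.summable_abs_mul_norm hM ht.1) (h.summable_sq_mul_norm ht.1))
  equation t ht α := by
    have hs := h.summable_norm hM ht.1
    refine ⟨(synth (rhs (a t)) α).re, ?_, ?_⟩
    · exact (Complex.reCLM.hasFDerivAt.comp_hasDerivWithinAt t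
        (h.hasDerivWithinAt_synth hM ht.1 (α : Torus))).mono Icc_subset_Ici_self
    · have hd : HasDerivAt (fun α : ℝ => (synth (a t) (α : Torus)).re)
          (synth (fun k => Complex.I * k * a t k) (α : Torus)).re α :=
        Complex.reCLM.hasFDerivAt.comp_hasDerivAt α
          (hasDerivAt_synth hs (h.summable_abs_mul_norm hM ht.1) α)
      have h1 := congrArg Complex.re (h.synth_rhs hM ht.1 α)
      rw [← ofReal_re_synth (h.real t ht.1), ← Complex.ofReal_pow, Complex.add_re,
        Complex.re_ofReal_mul, Complex.neg_re] at h1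
      rw [hd.deriv, lambdaInv_synth (h.real t ht.1) hs]
      exact h1
  initial := by
    refine ae_eq_of_coeff_eq (memLp_re_synth (h.summable_norm hM le_rfl)) hu₀ fun k => ?_
    rw [coeff_re_synth (h.real 0 le_rfl) (h.summable_norm hM le_rfl), h.init, ha₀]

lemma eLpNorm_le (h : IsSpectral M a₀ a) (hM : 0 ≤ M) {t : ℝ} (ht : 0 ≤ t) :
    eLpNorm (fun x => (synth (a t) x).re) 2 (volume : Measure Torus) ≤
      ENNReal.ofReal (√(2 * π) * (12 * M) * (1 + t) ^ (-(1.25 : ℝ))) := by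
  have hs := h.summable_norm hM ht
  have h1 : (0 : ℝ) < 1 + t := by linarith
  -- `12² ≥ 129`; the rate `(1+t)⁻²` is then weakened to the exponent `-1.25`.
  refine (eLpNorm_le_of_sum_le (memLp_re_synth hs) (B := 12 * M / (1 + t) ^ 2) (by positivity)
    fun S => ?_).trans (ENNReal.ofReal_le_ofReal ?_)
  · simp only [coeff_re_synth (h.real t ht) hs]
    refine (h.decay t ht S).trans ?_
    rw [div_pow, ← pow_mul]
    gcongr
    nlinarith [sq_nonneg M]
  · rw [mul_assoc, div_eq_mul_inv]
    gcongr
    rw [← rpow_natCast, ← rpow_neg h1.le]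
    exact rpow_le_rpow_of_exponent_le (by linarith) (by norm_num)

end IsSpectral

lemma isRealSeq_coeff {u : Torus → ℝ} (h0 : ∫ x, u x ∂volume = 0) : IsRealSeq (coeff u) where
  zero := by
    rw [coeff, fourierCoeff]
    simp only [neg_zero, fourier_zero, one_smul]
    refine (integral_ofReal (𝕜 := ℂ)).trans ?_
    rw [AddCircle.integral_haarAddCircle, h0, smul_zero, RCLike.ofReal_zero]
  neg k := by
    rw [coeff, coeff, fourierCoeff, fourierCoeff, ← integral_conj]
    refine integral_congr_ae (Eventually.of_forall fun x => ?_)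
    simp only [smul_eq_mul, map_mul, Complex.conj_ofReal, neg_neg, fourier_neg,
      Complex.conj_conj]

end

end CubicLocalModel

end


/-! ### Choice of the constants and conclusion -/

theorem mainTheorem4 :
    ∃ ε : ℝ, 0 < ε ∧ ∃ C : ℝ, 0 < C ∧
      ∀ u₀ : CubicLocalModel.Torus → ℝ,
        CubicLocalModel.MemHdot 3 u₀ →
        ∫ x, u₀ x ∂volume = 0 →
        CubicLocalModel.normHdot 3 u₀ ≤ ε →
        ∃ u : ℝ → CubicLocalModel.Torus → ℝ,
          (∀ T : ℝ, 0 < T → CubicLocalModel.IsSolution T u₀ u) ∧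
          ∀ t : ℝ, 0 ≤ t →
            eLpNorm (u t) 2 volume ≤ ENNReal.ofReal (C * (1 + t) ^ (-(1.25 : ℝ))) := by
  have hK := CubicLocalModel.embConst_nonneg
  -- With `(448 * embConst + 1) * ε = 1` and `ε ≤ 1`, the smallness condition on `ε²` follows
  -- without a square root.
  set ε : ℝ := 1 / (448 * CubicLocalModel.embConst + 1) with hε
  have hε0 : 0 < ε := by positivity
  have hM : 448 * CubicLocalModel.embConst * ε ^ 2 ≤ 1 := by
    have h1 : (448 * CubicLocalModel.embConst + 1) * ε = 1 := by
      rw [hε]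
      field_simp
    have h2 : ε ≤ 1 := by
      nlinarith [mul_nonneg hK hε0.le]
    nlinarith [mul_nonneg hK hε0.le]
  refine ⟨ε, hε0, √(2 * π) * (12 * ε), by positivity, fun u₀ hu₀ hmean hnorm => ?_⟩
  have hsum : ∀ S : Finset ℤ, ∑ k ∈ S, |(k : ℝ)| ^ 6 * ‖CubicLocalModel.coeff u₀ k‖ ^ 2 ≤ ε ^ 2 := by
    intro S
    refine (hu₀.2.sum_le_tsum S fun _ _ => by positivity).trans ?_
    exact (sqrt_le_left hε0.le).mp hnorm
  obtain ⟨a, ha⟩ := CubicLocalModel.exists_isSpectral hε0.le hM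
    (CubicLocalModel.isRealSeq_coeff hmean) hsum
  exact ⟨fun t x => (CubicLocalModel.synth (a t) x).re,
    fun T _ => ha.isSolution hε0.le hu₀.1 (fun _ => rfl) T,
    fun t ht => ha.eLpNorm_le hε0.le ht⟩
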